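/- **Setting.** Let $M$ be a four-dimensional smooth manifold with a Lorentzian metric $g$ of signature $(+,-,-,-)$ and a global $g$-orthonormal tetrad $e_0,\dots,e_3$, $g(e_A,e_B)=\eta_{AB}=\mathrm{diag}(1,-1,-1,-1)$. Let $\gamma^A$ be the Dirac matrices in the Dirac representation, $\gamma_5=i\gamma^0\gamma^1\gamma^2\gamma^3$, $\bar\Psi=\Psi^\dagger\gamma^0$, and $\varepsilon_{ABCD}$ the Levi-Civita tensor with $\varepsilon_{0123}=1$. For a spinor field $\Psi:M\to\mathbb C^4$ (components with respect to the tetrad) put $$\nabla_A\Psi=e_A(\Psi)+\tfrac18\gamma_{BCA}[\gamma^B,\gamma^C]\Psi,\quad \gamma_{ABC}=\tfrac12(C_{ABC}-C_{BAC}-C_{CAB}),\quad C_{ABC}=g(e_A,[e_C,e_B]),$$ and $A=\bar\Psi\Psi$, $B=i\bar\Psi\gamma_5\Psi$, $J^A=\bar\Psi\gamma^A\Psi$, $I^A=\bar\Psi\gamma^A\gamma_5\Psi$, $J^2=J_AJ^A$. Assume that $J$ is time-like, $J^2>0$, and let $V=J/\sqrt{J^2}$. Let $\alpha,\beta$ be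 real functions with $\alpha>0$ and $\alpha+\beta>0$; all objects are of class $C^n$ for some $2\le n\le\infty$. Let $\hat g$ be the disformal metric $$\hat g^{\mu\nu}=\alpha g^{\mu\nu}+\beta V^\mu V^\nu,\qquad\text{that is}\qquad \hat g_{\mu\nu}=\tfrac1\alpha g_{\mu\nu}-\tfrac{\beta}{\alpha(\alpha+\beta)}V_\mu V_\nu ,$$ and put $a=\sqrt\alpha$, $b=\sqrt{\alpha+\beta}-\sqrt\alpha$ (so $\alpha=a^2$, $\beta=b(b+2a)$) and $\hat e_A=a\,e_A+b\,V_AV$. Let $m$ be a real number. The modified Dirac equation in $\hat g$ is $i\hat\gamma^\mu\hat\nabla_\mu\Psi-\sqrt\alpha\,m\Psi=0$ with $\hat\gamma^\mu=\hat e^\mu{}_A\gamma^A$ and $\hat\nabla$ formed from $\hat g,\hat e$ in the same way; the Dirac equation in $g$ is $i\gamma^\mu\nabla_\mu\Psi-m\Psi=0$ with $\gamma^\mu=e^\mu{}_A\gamma^A$. For the Levi-Civita connection of $g$ let $\dot V_A=V^B\nabla_BV_A$, $h_A{}^B=\delta_A^B-V_AV^B$, $\omega_{BC}=\tfrac12h_B{}^Dh_C{}^E(\nabla_EV_D-\nabla_DV_E)$,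 $\omega^A=-\tfrac12\varepsilon^{ABCD}\omega_{BC}V_D$. For a function $f$ let $\partial_Cf=e_C(f)$, $\dot f=V^A\partial_Af$, $f'=I^A\partial_Af$. The *generalized Inomata condition* with functions $s_0,\dots,s_4:M\to\mathbb C$ is $$\nabla_B\Psi=\Big(s_0-\frac{mB\gamma_5}{3\sqrt{J^2}}\Big)V_B\Psi-\Big(s_0+\frac{imA}{\sqrt{J^2}}-\frac{4mB\gamma_5}{3\sqrt{J^2}}\Big)\frac{(A-iB\gamma_5)\gamma_B}{4\sqrt{J^2}}\Psi+\gamma_B\gamma_C\omega^C(s_1+s_2\gamma_5)\Psi+\omega_B(s_3+s_4\gamma_5)\Psi .$$ Let $\mathcal C$ be the class of the $\Psi$ that satisfy this condition for some $s_0,\dots,s_4$ with $$s_3=-4s_1,\quad s_4=-4s_2,\quad s_0=\frac{imA}{3\sqrt{J^2}}+\frac23\big(\ln\sqrt{J^2}\big)^{\textstyle\cdot},\quad s_2=-\frac{ib}{2(a+b)},$$ $$b\,\dot V_A=\frac{h_A{}^C\big((3a+2b)\,\partial_Ca+a\,\partial_Cb\big)}{a+b}-2b\,s_1\omega_A,$$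 together with the constraints on the tetrad coefficients that come from the conservation laws of the vector and axial currents, $$\dot a=0,\qquad 2\frac{a'}{a}+\frac{a'+b'}{a+b}=0 .$$ **Theorem.** (1) $\hat g$ is a Lorentzian metric, its contravariant components are $\alpha g^{\mu\nu}+\beta V^\mu V^\nu$, and $\hat e_A$ is a tetrad for it. (2) Every $\Psi$ that satisfies the generalized Inomata condition for some functions $s_0,\dots,s_4$ with $s_3=-4s_1$ and $s_4=-4s_2$ solves the Dirac equation, massive or massless, in the target metric $g$. (3) Every $\Psi$ in $\mathcal C$ solves both the modified Dirac equation in the disformal metric $\hat g$ and the Dirac equation, massive or massless, in the target metric $g$. (4) For every real $m$ the class is non-empty for some space-time on $\mathbb R^4$ and some smooth $\alpha,\beta$ with $\beta$ nowhere zero. -/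

import Mathlib

open scoped Manifold ContDiff Matrix

namespace DisformalDirac

noncomputable section

/-! Algebra: the Minkowski metric, the Dirac matrices and the bilinears of a Dirac spinor. -/

/-- Values of a Dirac spinor field in a tetrad: four complex components. -/
abbrev Spinor : Type := Fin 4 → ℂ

/-- The diagonal of `η = diag(1, -1, -1, -1)`. -/
def eta : Fin 4 → ℝ := ![1, -1, -1, -1]

/-- The constant Dirac matrices `γ^A` in the Dirac representation. -/
def gam : Fin 4 → Matrix (Fin 4) (Fin 4) ℂ :=
  ![!![1, 0, 0, 0; 0, 1, 0, 0; 0, 0, -1, 0; 0, 0, 0, -1],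
    !![0, 0, 0, 1; 0, 0, 1, 0; 0, -1, 0, 0; -1, 0, 0, 0],
    !![0, 0, 0, -Complex.I; 0, 0, Complex.I, 0; 0, Complex.I, 0, 0; -Complex.I, 0, 0, 0],
    !![0, 0, 1, 0; 0, 0, 0, -1; -1, 0, 0, 0; 0, 1, 0, 0]]

/-- The Dirac matrices with lowered index, `γ_A = η_{AB} γ^B`. -/
def gamLow (A : Fin 4) : Matrix (Fin 4) (Fin 4) ℂ := (eta A : ℂ) • gam A

/-- `γ₅ = i γ⁰ γ¹ γ² γ³`. -/
def gam5 : Matrix (Fin 4) (Fin 4) ℂ := Complex.I • (gam 0 * gam 1 * gam 2 * gam 3)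

/-- The Levi-Civita tensor `ε^{ABCD}` with upper tetrad indices, normalized by `ε_{0123} = 1`,
that is by `ε^{0123} = -1`. -/
def eps (A B C D : Fin 4) : ℝ :=
  -Matrix.det (Matrix.of fun i j : Fin 4 => if ![A, B, C, D] i = j then (1 : ℝ) else 0)

/-- `Ψ̄ Q Ψ`, with `Ψ̄ = Ψ† γ⁰`. -/
def bilin (Q : Matrix (Fin 4) (Fin 4) ℂ) (ψ : Spinor) : ℂ :=
  star ψ ⬝ᵥ ((gam 0 * Q) *ᵥ ψ)

/-- The scalar `A = Ψ̄ Ψ` (a real number). -/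
def scalarA (ψ : Spinor) : ℝ := (bilin 1 ψ).re

/-- The scalar `B = i Ψ̄ γ₅ Ψ` (a real number). -/
def scalarB (ψ : Spinor) : ℝ := (Complex.I * bilin gam5 ψ).re

/-- The tetrad components `J^A = Ψ̄ γ^A Ψ` of the Dirac current. -/
def current (ψ : Spinor) (A : Fin 4) : ℝ := (bilin (gam A) ψ).re

/-- The tetrad components `I^A = Ψ̄ γ^A γ₅ Ψ` of the axial current. -/
def axial (ψ : Spinor) (A : Fin 4) : ℝ := (bilin (gam A * gam5) ψ).re

/-- `J² = g(J, J)`. -/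
def currentSq (ψ : Spinor) : ℝ := ∑ A, eta A * current ψ A ^ 2

/-- The norm `√J²` of a time-like Dirac current. -/
def currentNorm (ψ : Spinor) : ℝ := √(currentSq ψ)

/-- The tetrad components `V^A = J^A / √J²` of the normalized Dirac current. -/
def vel (ψ : Spinor) (A : Fin 4) : ℝ := current ψ A / currentNorm ψ

/-- `V_A = η_{AB} V^B`. -/
def velLow (ψ : Spinor) (A : Fin 4) : ℝ := eta A * vel ψ A

/-- The projector `h_A{}^B = δ_A^B - V_A V^B` orthogonal to `V`. -/
def proj (ψ : Spinor) (A B : Fin 4) : ℝ := (if A = B then 1 else 0) - velLow ψ A * vel ψ B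

/-! Geometry: metrics and tetrads on a four-dimensional manifold. -/

section Geometry

variable {M : Type*} [TopologicalSpace M] [ChartedSpace (EuclideanSpace ℝ (Fin 4)) M]

/-- A field of bilinear forms on the tangent spaces. -/
abbrev FormField (M : Type*) [TopologicalSpace M]
    [ChartedSpace (EuclideanSpace ℝ (Fin 4)) M] : Type _ :=
  ∀ p : M, LinearMap.BilinForm ℝ (TangentSpace (𝓡 4) p)

/-- A quadruple of vector fields. -/
abbrev Frame (M : Type*) [TopologicalSpace M]
    [ChartedSpace (EuclideanSpace ℝ (Fin 4)) M] : Type _ :=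
  Fin 4 → ∀ p : M, TangentSpace (𝓡 4) p

/-- Vector fields of class `C^n`. -/
def IsVectorField [IsManifold (𝓡 4) ∞ M] (n : ℕ∞) (X : ∀ p : M, TangentSpace (𝓡 4) p) : Prop :=
  ContMDiff (𝓡 4) (𝓡 4).tangent (n : WithTop ℕ∞)
    (fun p => (⟨p, X p⟩ : TangentBundle (𝓡 4) M))

/-- Lorentzian metrics of class `C^n` and of signature `(+,-,-,-)`. -/
structure IsLorentzMetric [IsManifold (𝓡 4) ∞ M] (n : ℕ∞) (g : FormField M) : Prop where
  symm : ∀ p X Y, g p X Y = g p Y X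
  signature : ∀ p, ∃ v : Module.Basis (Fin 4) ℝ (TangentSpace (𝓡 4) p),
    ∀ A B, g p (v A) (v B) = if A = B then eta A else 0
  regular : ∀ X Y : (∀ p : M, TangentSpace (𝓡 4) p), IsVectorField n X → IsVectorField n Y →
    ContMDiff (𝓡 4) 𝓘(ℝ, ℝ) (n : WithTop ℕ∞) (fun p => g p (X p) (Y p))

/-- Tetrads of class `C^n` for `g`: `g(e_A, e_B) = η_{AB}`. -/
structure IsTetrad [IsManifold (𝓡 4) ∞ M] (n : ℕ∞) (g : FormField M) (e : Frame M) : Prop where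
  regular : ∀ A, IsVectorField n (e A)
  orthonormal : ∀ p A B, g p (e A p) (e B p) = if A = B then eta A else 0

/-- The derivative of a vector-valued function along a vector field. -/
def dirDeriv {F : Type*} [NormedAddCommGroup F] [NormedSpace ℝ F]
    (X : ∀ p : M, TangentSpace (𝓡 4) p) (f : M → F) (p : M) : F :=
  mfderiv (𝓡 4) 𝓘(ℝ, F) f p (X p)

/-- `C_{ABC} = g(e_A, [e_C, e_B])`. -/
def structureFn (g : FormField M) (e : Frame M) (A B C : Fin 4) (p : M) : ℝ :=
  g p (e A p) (VectorField.mlieBracket (𝓡 4) (e C) (e B) p)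

/-- The spin connection `γ_{ABC} = (C_{ABC} - C_{BAC} - C_{CAB}) / 2`; it equals
`g(e_A, ∇_{e_C} e_B)` for the Levi-Civita connection of `g`. -/
def spinConn (g : FormField M) (e : Frame M) (A B C : Fin 4) (p : M) : ℝ :=
  (structureFn g e A B C p - structureFn g e B A C p - structureFn g e C A B p) / 2

/-- The covariant derivative `∇_A Ψ = e_A(Ψ) - Γ_A Ψ` of a spinor field, with the Fock-Ivanenko
connection `Γ_A = -(1/8) γ_{BCA} [γ^B, γ^C]`. -/
def nablaSpinor (g : FormField M) (e : Frame M) (Ψ : M → Spinor) (A : Fin 4) (p : M) : Spinor :=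
  dirDeriv (e A) Ψ p +
    ∑ B, ∑ C, ((spinConn g e B C A p / 8 : ℝ) : ℂ) •
      ((gam B * gam C - gam C * gam B) *ᵥ Ψ p)

/-- The Dirac equation `i γ^μ ∇_μ Ψ - μ Ψ = 0` with mass function `μ`. -/
def DiracEquation (g : FormField M) (e : Frame M) (μ : M → ℝ) (Ψ : M → Spinor) : Prop :=
  ∀ p, Complex.I • (∑ A, gam A *ᵥ nablaSpinor g e Ψ A p) - (μ p : ℂ) • Ψ p = 0

/-- `∇_C V_B`, the tetrad components of the Levi-Civita derivative of `V`. -/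
def nablaVel (g : FormField M) (e : Frame M) (Ψ : M → Spinor) (B C : Fin 4) (p : M) : ℝ :=
  dirDeriv (e C) (fun q => velLow (Ψ q) B) p + ∑ D, spinConn g e B D C p * vel (Ψ p) D

/-- The acceleration `V̇_A = V^B ∇_B V_A`. -/
def accel (g : FormField M) (e : Frame M) (Ψ : M → Spinor) (A : Fin 4) (p : M) : ℝ :=
  ∑ B, vel (Ψ p) B * nablaVel g e Ψ A B p

/-- The vorticity tensor `ω_{BC} = h_B{}^D h_C{}^E (∇_E V_D - ∇_D V_E) / 2`. -/
def vortTensor (g : FormField M) (e : Frame M) (Ψ : M → Spinor) (B C : Fin 4) (p : M) : ℝ :=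
  (∑ D, ∑ E, proj (Ψ p) B D * proj (Ψ p) C E *
    (nablaVel g e Ψ D E p - nablaVel g e Ψ E D p)) / 2

/-- The vorticity vector `ω^A = -(1/2) ε^{ABCD} ω_{BC} V_D`. -/
def vort (g : FormField M) (e : Frame M) (Ψ : M → Spinor) (A : Fin 4) (p : M) : ℝ :=
  -(∑ B, ∑ C, ∑ D, eps A B C D * vortTensor g e Ψ B C p * velLow (Ψ p) D) / 2

/-- `ω_A = η_{AB} ω^B`. -/
def vortLow (g : FormField M) (e : Frame M) (Ψ : M → Spinor) (A : Fin 4) (p : M) : ℝ :=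
  eta A * vort g e Ψ A p

/-- `ḟ = V^A e_A(f)`. -/
def dot (e : Frame M) (Ψ : M → Spinor) (f : M → ℝ) (p : M) : ℝ :=
  ∑ A, vel (Ψ p) A * dirDeriv (e A) f p

/-- `f' = I^A e_A(f)`. -/
def prime (e : Frame M) (Ψ : M → Spinor) (f : M → ℝ) (p : M) : ℝ :=
  ∑ A, axial (Ψ p) A * dirDeriv (e A) f p

/-- `h_A{}^C e_C(f)`. -/
def projGrad (e : Frame M) (Ψ : M → Spinor) (f : M → ℝ) (A : Fin 4) (p : M) : ℝ :=
  ∑ C, proj (Ψ p) A C * dirDeriv (e C) f p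

/-! The disformal metric and its tetrad. -/

/-- The vector field `V = V^A e_A`. -/
def velField (e : Frame M) (Ψ : M → Spinor) (p : M) : TangentSpace (𝓡 4) p :=
  ∑ A, vel (Ψ p) A • e A p

/-- The disformal metric
`ĝ_{μν} = (1/α) g_{μν} - β/(α(α+β)) V_μ V_ν`, with inverse `ĝ^{μν} = α g^{μν} + β V^μ V^ν`. -/
def disformal (g : FormField M) (e : Frame M) (α β : M → ℝ) (Ψ : M → Spinor) : FormField M :=
  fun p => (1 / α p) • g p -
    (β p / (α p * (α p + β p))) •
      (LinearMap.mul ℝ ℝ).compl₁₂ (g p (velField e Ψ p)) (g p (velField e Ψ p))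

/-- The tetrad coefficient `a`, the positive root of `α = a²`. -/
def coefA (α : M → ℝ) (p : M) : ℝ := √(α p)

/-- The tetrad coefficient `b`, the root of `β = b(b + 2a)` with `a + b > 0`. -/
def coefB (α β : M → ℝ) (p : M) : ℝ := √(α p + β p) - √(α p)

/-- The disformal tetrad `ê_A = a e_A + b V_A V`. -/
def disformalTetrad (e : Frame M) (α β : M → ℝ) (Ψ : M → Spinor) : Frame M :=
  fun A p => coefA α p • e A p + (coefB α β p * velLow (Ψ p) A) • velField e Ψ p

/-- The objects of class `C^n`: a space-time metric `g` with tetrad `e`, functions `α > 0`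
and `β` with `α + β > 0`, and a Dirac spinor field with time-like Dirac current. -/
structure IsSetting [IsManifold (𝓡 4) ∞ M] (n : ℕ∞) (g : FormField M) (e : Frame M)
    (α β : M → ℝ) (Ψ : M → Spinor) : Prop where
  metric : IsLorentzMetric n g
  tetrad : IsTetrad n g e
  regular_alpha : ContMDiff (𝓡 4) 𝓘(ℝ, ℝ) (n : WithTop ℕ∞) α
  regular_beta : ContMDiff (𝓡 4) 𝓘(ℝ, ℝ) (n : WithTop ℕ∞) β
  regular_spinor : ContMDiff (𝓡 4) 𝓘(ℝ, Spinor) (n : WithTop ℕ∞) Ψ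
  alpha_pos : ∀ p, 0 < α p
  add_pos : ∀ p, 0 < α p + β p
  timelike : ∀ p, 0 < currentSq (Ψ p)

/-! The generalized Inomata condition. -/

/-- `ω̸ = γ_C ω^C`. -/
def vortSlash (g : FormField M) (e : Frame M) (Ψ : M → Spinor) (p : M) :
    Matrix (Fin 4) (Fin 4) ℂ :=
  ∑ C, (vort g e Ψ C p : ℂ) • gamLow C

/-- The generalized Inomata condition
`∇_B Ψ = (s₀ - mBγ₅/(3√J²)) V_B Ψ
  - (s₀ + imA/√J² - 4mBγ₅/(3√J²)) (A - iBγ₅) γ_B/(4√J²) Ψ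
  + γ_B γ_C ω^C (s₁ + s₂γ₅) Ψ + ω_B (s₃ + s₄γ₅) Ψ`. -/
def InomataCondition (g : FormField M) (e : Frame M) (m : ℝ) (Ψ : M → Spinor)
    (s₀ s₁ s₂ s₃ s₄ : M → ℂ) : Prop :=
  ∀ p B, nablaSpinor g e Ψ B p =
    (velLow (Ψ p) B : ℂ) •
      ((s₀ p • 1 - (m * scalarB (Ψ p) / (3 * currentNorm (Ψ p)) : ℂ) • gam5) *ᵥ Ψ p)
    - (1 / (4 * currentNorm (Ψ p)) : ℂ) •
      ((((s₀ p + Complex.I * m * scalarA (Ψ p) / currentNorm (Ψ p)) • 1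
          - (4 * m * scalarB (Ψ p) / (3 * currentNorm (Ψ p)) : ℂ) • gam5)
        * ((scalarA (Ψ p) : ℂ) • 1 - (Complex.I * scalarB (Ψ p)) • gam5) * gamLow B) *ᵥ Ψ p)
    + (gamLow B * vortSlash g e Ψ p * (s₁ p • 1 + s₂ p • gam5)) *ᵥ Ψ p
    + (vortLow g e Ψ B p : ℂ) • ((s₃ p • 1 + s₄ p • gam5) *ᵥ Ψ p)

/-- The class of spinor fields: the generalized Inomata condition with the stated coefficients,
together with the constraints on the tetrad coefficients `a`, `b`. -/
def InInomataClass (g : FormField M) (e : Frame M) (α β : M → ℝ) (m : ℝ)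
    (Ψ : M → Spinor) : Prop :=
  ∃ s₀ s₁ s₂ : M → ℂ,
    InomataCondition g e m Ψ s₀ s₁ s₂ (fun p => -4 * s₁ p) (fun p => -4 * s₂ p) ∧
    (∀ p, s₀ p = Complex.I * m * scalarA (Ψ p) / (3 * currentNorm (Ψ p))
      + (2 / 3 : ℂ) * (dot e Ψ (fun q => Real.log (currentNorm (Ψ q))) p : ℂ)) ∧
    (∀ p, s₂ p = -(Complex.I * coefB α β p) / (2 * (coefA α p + coefB α β p))) ∧
    (∀ p A, (coefB α β p * accel g e Ψ A p : ℂ) =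
      (((3 * coefA α p + 2 * coefB α β p) * projGrad e Ψ (coefA α) A p
        + coefA α p * projGrad e Ψ (coefB α β) A p) / (coefA α p + coefB α β p) : ℝ)
      - 2 * coefB α β p * s₁ p * vortLow g e Ψ A p) ∧
    (∀ p, dot e Ψ (coefA α) p = 0) ∧
    (∀ p, 2 * prime e Ψ (coefA α) p / coefA α p
      + (prime e Ψ (coefA α) p + prime e Ψ (coefB α β) p) / (coefA α p + coefB α β p) = 0)

end Geometry

end

end DisformalDirac

open DisformalDirac

/-!
The Dirac operator `γ^A ∇_A` of a tetrad depends on the structure functions `C_{ABD}` only through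
their trace and their totally antisymmetric part, because `γ^A [γ^B, γ^C]` has only a vector and an
axial part (`sum_gam_spinTerm`). The structure functions of `ê_A = a e_A + b V_A V` in the metric
`ĝ`, in which this tetrad is orthonormal, follow from the product rule for brackets
(`IsSetting.structureFn_disformal`). Their trace and antisymmetric part give, for `ȧ = 0`,
`γ^A ∇̂_A Ψ = a γ^A ∇_A Ψ + b V̸ ∇_V Ψ`
`  + ½ (b θ V_D + b V̇_D - X_D) γ^D Ψ + (i/2) (b²/(a+b)) ω̸ γ₅ Ψ`
with `θ` the expansion of `V` and `X_D` the spatial gradient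
`h_D{}^C ((3a+2b) ∂_C a + a ∂_C b)/(a+b)` (`IsSetting.sum_gam_nablaSpinor_disformal`).

The generalized Inomata condition prescribes all of `∇_B Ψ`, hence both `γ^B ∇_B Ψ` and
`V̸ ∇_V Ψ`. The Fierz identities `J̸ Ψ = (A + i B γ₅) Ψ` and `J² = A² + B²` turn the first into
`-i m Ψ`, which is the Dirac equation in `g` (`sum_gam_inomataForm`); for the second they give
`(¾ s₀ - i m A/(4√J²)) V̸ Ψ + ω̸ (s₁ + s₂ γ₅) Ψ` (`slash_vel_sum_inomataForm`). The Dirac equation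
implies conservation of the vector current, so `θ = -(ln √J²)˙` (`IsSetting.expansion_eq`). With the
prescribed `s₀`, `s₂` and acceleration, all terms of the disformal Dirac operator but
`a γ^A ∇_A Ψ = -i a m Ψ` then cancel, and `a = √α` (`IsSetting.diracEquation_disformal`).

The class is non-empty because of a Gödel-type space-time, homogeneous and with rigidly rotating
`V = ∂_t`, in which a spinor that is constant up to a phase linear in `t` satisfies every condition
with constant `s₀`, `s₁`, `s₂`, `a` and `b` (`inInomataClass_goedel`). Its rotation is proportional
to `m`; for `m = 0` it is flat space with a constant spinor.
-/

namespace DisformalDirac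

noncomputable section

/-! ### The Levi-Civita symbol and the Dirac matrices -/

/-- The Levi-Civita symbol as a Vandermonde product of the indices; `12 = 1! 2! 3!`. -/
theorem eps_eq (A B C D : Fin 4) : eps A B C D =
    -(((B : ℝ) - A) * (C - A) * (D - A) * (C - B) * (D - B) * (D - C)) / 12 := by
  have key : ∀ A B C D : Fin 4,
      12 * Matrix.det (Matrix.of fun i j : Fin 4 => if ![A, B, C, D] i = j then (1 : ℤ) else 0) =
      ((B : ℤ) - A) * (C - A) * (D - A) * (C - B) * (D - B) * (D - C) := by
    simp only [Matrix.det_succ_row_zero, Matrix.det_fin_zero, Fin.sum_univ_succ, Fin.sum_univ_zero,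
      Matrix.of_apply, Matrix.submatrix_apply]
    decide +kernel
  have h : Matrix.det (Matrix.of fun i j : Fin 4 => if ![A, B, C, D] i = j then (1 : ℝ) else 0) =
      ((Matrix.of fun i j : Fin 4 =>
        if ![A, B, C, D] i = j then (1 : ℤ) else 0).map fun x => (x : ℝ)).det := by
    congr 1
    ext i j
    simp
  have := congrArg (Int.cast : ℤ → ℝ) (key A B C D)
  push_cast at this
  rw [eps, h]
  linarith

/-- The contraction `ε^{ABCD} S_{ABC}` of a three-index array with the Levi-Civita symbol `eps`,
written out; here `ε^{0123} = -1`. -/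
def alt (S : Fin 4 → Fin 4 → Fin 4 → ℝ) : Fin 4 → ℝ :=
  ![S 1 2 3 + S 2 3 1 + S 3 1 2 - S 1 3 2 - S 3 2 1 - S 2 1 3,
    -(S 0 2 3 + S 2 3 0 + S 3 0 2 - S 0 3 2 - S 3 2 0 - S 2 0 3),
    S 0 1 3 + S 1 3 0 + S 3 0 1 - S 0 3 1 - S 3 1 0 - S 1 0 3,
    -(S 0 1 2 + S 1 2 0 + S 2 0 1 - S 0 2 1 - S 2 1 0 - S 1 0 2)]

theorem sum_eps_left (S : Fin 4 → Fin 4 → Fin 4 → ℝ) (D : Fin 4) :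
    ∑ A, ∑ B, ∑ C, eps A B C D * S A B C = alt S D := by
  simp only [eps_eq, Fin.sum_univ_four]
  fin_cases D <;> simp [alt] <;> ring

theorem sum_eps_right (S : Fin 4 → Fin 4 → Fin 4 → ℝ) (D : Fin 4) :
    ∑ A, ∑ B, ∑ C, eps D A B C * S A B C = -alt S D := by
  rw [← sum_eps_left]
  simp only [← Finset.sum_neg_distrib, eps_eq]
  refine Finset.sum_congr rfl fun A _ => Finset.sum_congr rfl fun B _ =>
    Finset.sum_congr rfl fun C _ => ?_
  ring

theorem gam_zero_mulVec (ψ : Spinor) : gam 0 *ᵥ ψ = ![ψ 0, ψ 1, -ψ 2, -ψ 3] := by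
  ext i; fin_cases i <;> simp [gam, Matrix.mulVec, dotProduct, Fin.sum_univ_four]

theorem gam_one_mulVec (ψ : Spinor) : gam 1 *ᵥ ψ = ![ψ 3, ψ 2, -ψ 1, -ψ 0] := by
  ext i; fin_cases i <;> simp [gam, Matrix.mulVec, dotProduct, Fin.sum_univ_four]

theorem gam_two_mulVec (ψ : Spinor) : gam 2 *ᵥ ψ =
    ![-(Complex.I * ψ 3), Complex.I * ψ 2, Complex.I * ψ 1, -(Complex.I * ψ 0)] := by
  ext i; fin_cases i <;> simp [gam, Matrix.mulVec, dotProduct, Fin.sum_univ_four]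

theorem gam_three_mulVec (ψ : Spinor) : gam 3 *ᵥ ψ = ![ψ 2, -ψ 3, -ψ 0, ψ 1] := by
  ext i; fin_cases i <;> simp [gam, Matrix.mulVec, dotProduct, Fin.sum_univ_four]

theorem gam5_mulVec (ψ : Spinor) : gam5 *ᵥ ψ = ![ψ 2, ψ 3, ψ 0, ψ 1] := by
  simp only [gam5, Matrix.smul_mulVec, ← Matrix.mulVec_mulVec, gam_zero_mulVec, gam_one_mulVec,
    gam_two_mulVec, gam_three_mulVec]
  ext i; fin_cases i <;> simp [← mul_assoc]

/-- The vector contraction `Σ_A η_A (S_{AAD} - S_{ADA})`. -/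
def tr (S : Fin 4 → Fin 4 → Fin 4 → ℝ) (D : Fin 4) : ℝ :=
  ∑ A, eta A * (S A A D - S A D A)

/-- The decomposition of `γ^A [γ^B, γ^C]` into a vector and an axial part: contracted with
`γ^A [γ^B, γ^C]`, an array `S_{ABC}` is seen only through its trace and its antisymmetric part. -/
theorem sum_gam_commutator (S : Fin 4 → Fin 4 → Fin 4 → ℝ) (ψ : Spinor) :
    ∑ A, gam A *ᵥ (∑ B, ∑ C, (S A B C : ℂ) • ((gam B * gam C - gam C * gam B) *ᵥ ψ)) =
      (2 : ℂ) • ∑ D, (tr S D : ℂ) • (gam D *ᵥ ψ)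
        - (2 * Complex.I) • ∑ D, (alt S D : ℂ) • (gamLow D *ᵥ (gam5 *ᵥ ψ)) := by
  simp only [Fin.sum_univ_four, tr, alt, gamLow, eta, Matrix.sub_mulVec, ← Matrix.mulVec_mulVec,
    Matrix.smul_mulVec, gam_zero_mulVec, gam_one_mulVec, gam_two_mulVec, gam_three_mulVec,
    gam5_mulVec]
  ext i; fin_cases i <;> simp <;> ring_nf <;> simp only [Complex.I_sq] <;> ring

/-! ### Reality of the bilinears and the Fierz identities -/

theorem bilin_eq (Q : Matrix (Fin 4) (Fin 4) ℂ) (ψ : Spinor) :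
    bilin Q ψ = star ψ ⬝ᵥ (gam 0 *ᵥ (Q *ᵥ ψ)) := by
  rw [bilin, Matrix.mulVec_mulVec]

/-- `Ψ̄ Ψ` is real, so that taking the real part in `scalarA` loses nothing. -/
theorem ofReal_scalarA (ψ : Spinor) : (scalarA ψ : ℂ) = bilin 1 ψ := by
  rw [scalarA, ← Complex.conj_eq_iff_re]
  simp [bilin_eq, gam_zero_mulVec, dotProduct, Fin.sum_univ_four, mul_comm]

theorem ofReal_scalarB (ψ : Spinor) : (scalarB ψ : ℂ) = Complex.I * bilin gam5 ψ := by
  rw [scalarB, ← Complex.conj_eq_iff_re]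
  simp [bilin_eq, gam_zero_mulVec, gam5_mulVec, dotProduct, Fin.sum_univ_four]
  ring

theorem ofReal_current (ψ : Spinor) (A : Fin 4) : (current ψ A : ℂ) = bilin (gam A) ψ := by
  rw [current, ← Complex.conj_eq_iff_re]
  fin_cases A <;> simp [bilin_eq, gam_zero_mulVec, gam_one_mulVec, gam_two_mulVec,
    gam_three_mulVec, dotProduct, Fin.sum_univ_four] <;> ring

theorem ofReal_axial (ψ : Spinor) (A : Fin 4) :
    (axial ψ A : ℂ) = bilin (gam A * gam5) ψ := by
  rw [axial, ← Complex.conj_eq_iff_re]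
  fin_cases A <;> simp [bilin_eq, gam_zero_mulVec, gam_one_mulVec, gam_two_mulVec,
    gam_three_mulVec, gam5_mulVec, ← Matrix.mulVec_mulVec, dotProduct, Fin.sum_univ_four] <;> ring

/-- The Fierz identity `J̸ Ψ = (A + i B γ₅) Ψ`. -/
theorem currentSlash_mulVec (ψ : Spinor) :
    ∑ A, ((eta A * current ψ A : ℝ) : ℂ) • (gam A *ᵥ ψ) =
      (scalarA ψ : ℂ) • ψ + (Complex.I * scalarB ψ) • (gam5 *ᵥ ψ) := by
  simp only [Complex.ofReal_mul, ofReal_current, ofReal_scalarA, ofReal_scalarB, bilin_eq,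
    Fin.sum_univ_four, gam_zero_mulVec, gam_one_mulVec, gam_two_mulVec,
    gam_three_mulVec, gam5_mulVec]
  ext i; fin_cases i <;> simp [eta, dotProduct, Fin.sum_univ_four] <;> ring_nf <;>
    simp only [Complex.I_sq] <;> ring

/-- The Fierz identity `J² = A² + B²`. -/
theorem currentSq_eq (ψ : Spinor) : currentSq ψ = scalarA ψ ^ 2 + scalarB ψ ^ 2 := by
  have h : (currentSq ψ : ℂ) = (scalarA ψ : ℂ) ^ 2 + (scalarB ψ : ℂ) ^ 2 := by
    simp only [currentSq, Complex.ofReal_sum, Complex.ofReal_mul, Complex.ofReal_pow]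
    simp only [ofReal_current, ofReal_scalarA, ofReal_scalarB, bilin_eq, Fin.sum_univ_four,
      gam_zero_mulVec, gam_one_mulVec, gam_two_mulVec, gam_three_mulVec, gam5_mulVec]
    simp [eta, dotProduct, Fin.sum_univ_four]
    ring_nf
    simp only [Complex.I_sq]
    ring
  exact_mod_cast h

theorem gam5_gam5_mulVec (ψ : Spinor) : gam5 *ᵥ (gam5 *ᵥ ψ) = ψ := by
  simp only [gam5_mulVec]
  ext i; fin_cases i <;> simp

theorem gam_gam5_mulVec (A : Fin 4) (ψ : Spinor) :
    gam A *ᵥ (gam5 *ᵥ ψ) = -(gam5 *ᵥ (gam A *ᵥ ψ)) := by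
  fin_cases A <;> simp [gam5_mulVec, gam_zero_mulVec, gam_one_mulVec, gam_two_mulVec,
    gam_three_mulVec]

theorem sum_gam_gamLow_mulVec (ψ : Spinor) : ∑ A, gam A *ᵥ (gamLow A *ᵥ ψ) = (4 : ℂ) • ψ := by
  simp only [gamLow, Matrix.smul_mulVec, Matrix.mulVec_smul, Fin.sum_univ_four, gam_zero_mulVec,
    gam_one_mulVec, gam_two_mulVec, gam_three_mulVec, eta]
  ext i; fin_cases i <;> simp <;> ring_nf <;> simp only [Complex.I_sq] <;> ring

theorem sum_slash_sq (v : Fin 4 → ℝ) (ψ : Spinor) :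
    ∑ A, ∑ B, ((v A * v B : ℝ) : ℂ) • (gam A *ᵥ (gam B *ᵥ ψ)) =
      ((∑ A, eta A * v A ^ 2 : ℝ) : ℂ) • ψ := by
  simp only [Fin.sum_univ_four, gam_zero_mulVec,
    gam_one_mulVec, gam_two_mulVec, gam_three_mulVec, eta]
  ext i; fin_cases i <;> simp <;> ring_nf <;> simp only [Complex.I_sq] <;> ring

/-! ### Structure functions of the disformal tetrad at a point -/

section Pointwise

/-- The connection coefficients as a function of the structure functions.

Here and in what follows, an array `C` stands for the values at a point of the structure functions
`C_{ABD}`, `V` for those of the components of a vector field, and `dV A B` for `e_B(V^A)`. -/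
def conn (C : Fin 4 → Fin 4 → Fin 4 → ℝ) (A B D : Fin 4) : ℝ :=
  (C A B D - C B A D - C D A B) / 2

/-- The components `g(e_A, [V, e_B])`. -/
def velBracket (C : Fin 4 → Fin 4 → Fin 4 → ℝ) (V : Fin 4 → ℝ) (dV : Fin 4 → Fin 4 → ℝ)
    (A B : Fin 4) : ℝ :=
  ∑ D, V D * C A B D - eta A * dV A B

/-- The components `V^B e_B(V_A)`. -/
def velAlong (V : Fin 4 → ℝ) (dV : Fin 4 → Fin 4 → ℝ) (A : Fin 4) : ℝ :=
  eta A * ∑ B, V B * dV A B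

/-- The components `g(V, [V, e_B])`. -/
def velVelBracket (C : Fin 4 → Fin 4 → Fin 4 → ℝ) (V : Fin 4 → ℝ) (dV : Fin 4 → Fin 4 → ℝ)
    (B : Fin 4) : ℝ :=
  ∑ A, V A * velBracket C V dV A B

/-- The components `g(V, [e_D, e_B])`. -/
def velStructure (C : Fin 4 → Fin 4 → Fin 4 → ℝ) (V : Fin 4 → ℝ) (B D : Fin 4) : ℝ :=
  ∑ A, V A * C A B D

/-- The structure functions of the tetrad `a e_A + b V_A V` in its own metric. -/
def hatStructure (C : Fin 4 → Fin 4 → Fin 4 → ℝ) (V : Fin 4 → ℝ) (dV : Fin 4 → Fin 4 → ℝ)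
    (a b : ℝ) (da db : Fin 4 → ℝ) (A B D : Fin 4) : ℝ :=
  a * C A B D - b * (eta B * V B) * velBracket C V dV A D
    + b * (eta D * V D) * velBracket C V dV A B
    + a⁻¹ * ((a * da D + b * (eta D * V D) * ∑ E, V E * da E) * (if A = B then eta A else 0)
      - (a * da B + b * (eta B * V B) * ∑ E, V E * da E) * (if A = D then eta A else 0))
    + (a + b)⁻¹ * (eta A * V A) *
      (a * (db D * (eta B * V B) - db B * (eta D * V D))
        + a * b * (eta B * dV B D - eta D * dV D B)
        + b ^ 2 * (eta D * V D * velAlong V dV B - eta B * V B * velAlong V dV D))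
    - b * (a + b)⁻¹ * (eta A * V A) *
      (a * velStructure C V B D - b * (eta B * V B) * velVelBracket C V dV D
        + b * (eta D * V D) * velVelBracket C V dV B
        + a⁻¹ * ((a * da D + b * (eta D * V D) * ∑ E, V E * da E) * (eta B * V B)
          - (a * da B + b * (eta B * V B) * ∑ E, V E * da E) * (eta D * V D)))

variable {C : Fin 4 → Fin 4 → Fin 4 → ℝ} {V : Fin 4 → ℝ} {dV : Fin 4 → Fin 4 → ℝ}

theorem sum_vel_velAlong (ho : ∀ D, ∑ A, eta A * V A * dV A D = 0) :
    ∑ A, V A * velAlong V dV A = 0 := by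
  have h : ∑ A, V A * velAlong V dV A = ∑ D, V D * ∑ A, eta A * V A * dV A D := by
    simp only [velAlong, Fin.sum_univ_four]; ring
  simp [h, ho]

theorem sum_vel_velVelBracket (hC : ∀ A B D, C A B D = -C A D B)
    (ho : ∀ D, ∑ A, eta A * V A * dV A D = 0) : ∑ A, V A * velVelBracket C V dV A = 0 := by
  have h : ∑ A, V A * velVelBracket C V dV A =
      (∑ A, V A * ∑ B, ∑ D, V B * V D * (C A B D + C A D B)) / 2
        - ∑ D, V D * ∑ A, eta A * V A * dV A D := by
    simp only [velVelBracket, velBracket, Fin.sum_univ_four]; ring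
  have h0 : ∀ A B D, C A B D + C A D B = 0 := fun A B D => by rw [hC A B D]; ring
  simp [h, ho, h0]

theorem sum_vel_velStructure (ho : ∀ D, ∑ A, eta A * V A * dV A D = 0) (B : Fin 4) :
    ∑ D, V D * velStructure C V B D = velVelBracket C V dV B := by
  have h : ∑ D, V D * velStructure C V B D = velVelBracket C V dV B
      + ∑ A, eta A * V A * dV A B := by
    simp only [velVelBracket, velStructure, velBracket, Fin.sum_univ_four]; ring
  rw [h, ho, add_zero]

theorem conn_antisymm (hC : ∀ A B D, C A B D = -C A D B) (A B D : Fin 4) :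
    conn C A B D = -conn C B A D := by
  simp only [conn]; rw [hC D A B]; ring

/-- The expansion `∇_A V^A`. -/
def expansion (C : Fin 4 → Fin 4 → Fin 4 → ℝ) (V : Fin 4 → ℝ) (dV : Fin 4 → Fin 4 → ℝ) : ℝ :=
  ∑ A, eta A * (eta A * dV A A + ∑ E, conn C A E A * V E)

theorem eta_mul_eta (A : Fin 4) : eta A * eta A = 1 := by
  fin_cases A <;> simp [eta]

theorem sum_eta_velBracket (hC : ∀ A B D, C A B D = -C A D B) :
    ∑ A, eta A * velBracket C V dV A A = -expansion C V dV := by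
  rw [expansion, ← Finset.sum_neg_distrib]
  refine Finset.sum_congr rfl fun A _ => ?_
  have : ∑ E, conn C A E A * V E = -∑ D, V D * C A A D := by
    rw [← Finset.sum_neg_distrib]
    refine Finset.sum_congr rfl fun E _ => ?_
    have h : C E A A = 0 := by linarith [hC E A A]
    rw [conn, hC A E A, h]; ring
  rw [this, velBracket]; ring

/-- The components of the acceleration. -/
def acceleration (C : Fin 4 → Fin 4 → Fin 4 → ℝ) (V : Fin 4 → ℝ) (dV : Fin 4 → Fin 4 → ℝ)
    (D : Fin 4) : ℝ :=
  ∑ B, V B * (eta D * dV D B + ∑ E, conn C D E B * V E)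

/-- The acceleration differs from the derivative of the components `V_D` along `V` by a connection
term, which the rotation of the tetrad along `V` supplies to the Dirac operator. -/
theorem acceleration_add (hC : ∀ A B D, C A B D = -C A D B) (D : Fin 4) :
    acceleration C V dV D + ∑ A, ∑ E, V A * V E * conn C A D E = velAlong V dV D := by
  simp only [conn_antisymm hC _ D]
  simp only [acceleration, velAlong, Fin.sum_univ_four]; ring

/-- The trace of the structure functions of the disformal tetrad, for `ȧ = 0`. Apart from the trace
for `e` and the connection along `V`, it involves only the expansion, the acceleration and the
spatial gradients of `a` and `b`. -/
theorem trace_hatStructure (hC : ∀ A B D, C A B D = -C A D B)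
    (hn : ∑ A, eta A * V A ^ 2 = 1) (ho : ∀ D, ∑ A, eta A * V A * dV A D = 0) {a b : ℝ}
    {da db : Fin 4 → ℝ} (ha : a ≠ 0) (hab : a + b ≠ 0) (hda : ∑ A, V A * da A = 0) (D : Fin 4) :
    ∑ A, eta A * hatStructure C V dV a b da db A D A =
      a * ∑ A, eta A * C A D A + b * ∑ A, ∑ E, V A * V E * conn C A D E
        + (b * (eta D * V D) * expansion C V dV + b * acceleration C V dV D
          - ((3 * a + 2 * b) * (da D - eta D * V D * ∑ A, V A * da A)
            + a * (db D - eta D * V D * ∑ A, V A * db A)) / (a + b)) := by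
  -- Take the trace term by term, keeping each contraction with `V` or `η` as a unit.
  have key : ∑ A, eta A * hatStructure C V dV a b da db A D A =
      a * ∑ A, eta A * C A D A
        - b * (eta D * V D) * ∑ A, eta A * velBracket C V dV A A
        + b * ∑ A, V A * velBracket C V dV A D
        - 3 * a⁻¹ * (a * da D + b * (eta D * V D) * ∑ E, V E * da E)
        + (a + b)⁻¹ * (a * (eta D * V D * ∑ A, V A * db A - db D * ∑ A, eta A * V A ^ 2)
          + a * b * (eta D * ∑ A, V A * dV D A - ∑ A, eta A * V A * dV A D)
          + b ^ 2 * (velAlong V dV D * ∑ A, eta A * V A ^ 2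
            - eta D * V D * ∑ A, V A * velAlong V dV A))
        - b * (a + b)⁻¹ * (a * ∑ A, V A * velStructure C V D A
          - b * (eta D * V D) * ∑ A, V A * velVelBracket C V dV A
          + b * velVelBracket C V dV D * ∑ A, eta A * V A ^ 2
          + a⁻¹ * ((a + b * ∑ A, eta A * V A ^ 2) * (∑ A, V A * da A) * (eta D * V D)
            - (a * da D + b * (eta D * V D) * ∑ E, V E * da E) * ∑ A, eta A * V A ^ 2)) := by
    simp only [hatStructure]
    generalize velBracket C V dV = W
    generalize velVelBracket C V dV = U
    generalize velStructure C V = X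
    generalize velAlong V dV = Y
    fin_cases D <;> simp [Fin.sum_univ_four, eta] <;> ring
  have h6 : ∑ A, V A * velBracket C V dV A D = velVelBracket C V dV D := rfl
  have h7 : eta D * ∑ B, V B * dV D B = velAlong V dV D := rfl
  rw [key, hn, ho, hda, sum_vel_velAlong ho, sum_vel_velVelBracket hC ho, sum_vel_velStructure ho,
    sum_eta_velBracket hC, h6, h7, ← acceleration_add hC D]
  field_simp
  ring

/-- The antisymmetric part of the structure functions of the disformal tetrad. The derivatives of
`a` and `b` drop out, being multiplied by a tensor symmetric in two indices; what is new is the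
connection along `V` and the vorticity. -/
theorem alt_hatStructure (hC : ∀ A B D, C A B D = -C A D B) {a b : ℝ}
    {da db : Fin 4 → ℝ} (hab : a + b ≠ 0) (D : Fin 4) :
    alt (hatStructure C V dV a b da db) D =
      a * alt C D
        + 16 * alt (fun A B E => b * (eta A * V A) * (∑ F, V F * conn C B E F) / 8) D
        - b ^ 2 / (a + b) * alt (fun A B E => eta A * V A *
          (eta B * dV B E - eta E * dV E B - velStructure C V B E)) D := by
  have hj : (a + b) * (a + b)⁻¹ = 1 := mul_inv_cancel₀ hab
  rw [div_eq_mul_inv]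
  unfold hatStructure
  generalize velVelBracket C V dV = U
  generalize velAlong V dV = Y
  generalize (a + b)⁻¹ = j at hj ⊢
  generalize a⁻¹ = i
  generalize ∑ A, V A * da A = s
  -- The two sides differ by the vorticity-type terms times `(a + b) (a + b)⁻¹ - 1`.
  have key := congrArg (fun x => x * (2 * b * alt (fun A B E => eta A * V A * (eta B * dV B E)) D
    - b * alt (fun A B E => eta A * V A * velStructure C V B E) D)) hj
  -- Antisymmetry is built into the parametrization, which leaves a polynomial identity.
  obtain ⟨K, rfl⟩ : ∃ K : Fin 4 → Fin 4 → Fin 4 → ℝ, C = fun A B E => K A B E - K A E B :=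
    ⟨fun A B E => C A B E / 2, by funext A B E; linarith [hC A E B]⟩
  simp only [velBracket, velStructure, conn, Fin.sum_univ_four] at key ⊢
  fin_cases D <;> simp [alt, eta] at key ⊢ <;> linear_combination key

end Pointwise

/-! ### The zeroth-order part of the Dirac operator -/

section Pointwise

variable {C : Fin 4 → Fin 4 → Fin 4 → ℝ} {V : Fin 4 → ℝ} {dV : Fin 4 → Fin 4 → ℝ}

/-- Antisymmetrization against `v` removes the projectors `h_A{}^F`, since `v ∧ v = 0`. -/
theorem alt_proj (v V : Fin 4 → ℝ) (Y : Fin 4 → Fin 4 → ℝ) (D : Fin 4) :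
    alt (fun A B E => (∑ F, ∑ G, ((if A = F then 1 else 0) - v A * V F) *
        ((if B = G then 1 else 0) - v B * V G) * (Y F G - Y G F)) / 2 * v E) D =
      alt (fun A B E => v A * (Y B E - Y E B)) D / 2 := by
  simp only [Fin.sum_univ_four]
  fin_cases D <;> simp [alt] <;> ring

/-- The zeroth-order part of the spinor derivative along `e_A`. -/
def spinTerm (C : Fin 4 → Fin 4 → Fin 4 → ℝ) (ψ : Spinor) (A : Fin 4) : Spinor :=
  ∑ B, ∑ D, ((conn C B D A / 8 : ℝ) : ℂ) • ((gam B * gam D - gam D * gam B) *ᵥ ψ)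

/-- The zeroth-order part of the Dirac operator depends only on the trace and on the antisymmetric
part of the structure functions. -/
theorem sum_gam_spinTerm (hC : ∀ A B D, C A B D = -C A D B) (ψ : Spinor) :
    ∑ A, gam A *ᵥ spinTerm C ψ A =
      (1 / 2 : ℂ) • ∑ D, ((∑ A, eta A * C A D A : ℝ) : ℂ) • (gam D *ᵥ ψ)
        - (Complex.I / 8) • ∑ D, (alt C D : ℂ) • (gamLow D *ᵥ (gam5 *ᵥ ψ)) := by
  have h := sum_gam_commutator (fun A B D => conn C B D A / 8) ψ
  have htr : ∀ D, tr (fun A B D => conn C B D A / 8) D = (∑ A, eta A * C A D A) / 4 := by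
    intro D
    rw [tr, Finset.sum_div]
    refine Finset.sum_congr rfl fun A _ => ?_
    simp only [conn]
    rw [hC A A D, show C D A A = 0 by linarith [hC D A A]]; ring
  have halt : ∀ D, alt (fun A B D => conn C B D A / 8) D = alt C D / 16 := by
    obtain ⟨K, rfl⟩ : ∃ K : Fin 4 → Fin 4 → Fin 4 → ℝ, C = fun A B E => K A B E - K A E B :=
      ⟨fun A B E => C A B E / 2, by funext A B E; linarith [hC A E B]⟩
    intro D
    fin_cases D <;> simp [alt, conn] <;> ring
  simp only [htr, halt] at h
  refine h.trans ?_
  simp only [Complex.ofReal_div, Finset.smul_sum, smul_smul]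
  congr 1 <;> refine Finset.sum_congr rfl fun D _ => ?_ <;> congr 1 <;> push_cast <;> ring

/-- The zeroth-order part of `b V̸ ∇_V`, split into vector and axial terms. -/
theorem slash_spinTerm (hC : ∀ A B D, C A B D = -C A D B) (b : ℝ) (ψ : Spinor) :
    ∑ A, ((b * (eta A * V A) : ℝ) : ℂ) • gam A *ᵥ (∑ F, (V F : ℂ) • spinTerm C ψ F) =
      (1 / 2 : ℂ) • ∑ D, ((b * ∑ A, ∑ E, V A * V E * conn C A D E : ℝ) : ℂ) • (gam D *ᵥ ψ)
        - (2 * Complex.I) • ∑ D, (alt (fun A B E => b * (eta A * V A) *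
          (∑ F, V F * conn C B E F) / 8) D : ℂ) • (gamLow D *ᵥ (gam5 *ᵥ ψ)) := by
  have h := sum_gam_commutator (fun A B E => b * (eta A * V A) * (∑ F, V F * conn C B E F) / 8) ψ
  have htr : ∀ D, tr (fun A B E => b * (eta A * V A) * (∑ F, V F * conn C B E F) / 8) D =
      (b * ∑ A, ∑ E, V A * V E * conn C A D E) / 4 := by
    intro D
    rw [tr, Finset.mul_sum, Finset.sum_div]
    refine Finset.sum_congr rfl fun A _ => ?_
    simp only [conn_antisymm hC D A, mul_neg, Finset.sum_neg_distrib, mul_assoc, ← Finset.mul_sum]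
    linear_combination (b * V A * (∑ F, V F * conn C A D F) / 4) * eta_mul_eta A
  simp only [htr] at h
  have hl : ∑ A, ((b * (eta A * V A) : ℝ) : ℂ) • gam A *ᵥ (∑ F, (V F : ℂ) • spinTerm C ψ F) =
      ∑ A, gam A *ᵥ ∑ B, ∑ E, ((b * (eta A * V A) * (∑ F, V F * conn C B E F) / 8 : ℝ) : ℂ) •
        ((gam B * gam E - gam E * gam B) *ᵥ ψ) := by
    refine Finset.sum_congr rfl fun A _ => ?_
    rw [← Matrix.mulVec_smul]
    congr 1
    simp only [spinTerm, Finset.smul_sum]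
    rw [Finset.sum_comm]
    refine Finset.sum_congr rfl fun B _ => ?_
    rw [Finset.sum_comm]
    refine Finset.sum_congr rfl fun E _ => ?_
    simp only [smul_smul, ← Finset.sum_smul]
    congr 1
    push_cast
    rw [Finset.mul_sum, Finset.sum_div]
    refine Finset.sum_congr rfl fun F _ => ?_
    ring
  rw [hl, h]
  congr 1
  simp only [Complex.ofReal_div, Finset.smul_sum, smul_smul]
  refine Finset.sum_congr rfl fun D _ => ?_
  congr 1
  push_cast
  ring

/-- The zeroth-order part of the Dirac operator of the disformal tetrad: `a` times that of the
original tetrad, plus `b V̸` times the connection along `V`, plus terms in the expansion, the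
acceleration, the gradients of `a` and `b`, and the vorticity `w`. -/
theorem sum_gam_spinTerm_hatStructure (hC : ∀ A B D, C A B D = -C A D B)
    (hn : ∑ A, eta A * V A ^ 2 = 1) (ho : ∀ D, ∑ A, eta A * V A * dV A D = 0) {a b : ℝ}
    {da db w : Fin 4 → ℝ} (ha : a ≠ 0) (hab : a + b ≠ 0) (hda : ∑ A, V A * da A = 0)
    (hhat : ∀ A B D, hatStructure C V dV a b da db A B D = -hatStructure C V dV a b da db A D B)
    (hw : ∀ D, w D = alt (fun A B E => eta A * V A *
          (eta B * dV B E - eta E * dV E B - velStructure C V B E)) D / 4) (ψ : Spinor) :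
    ∑ A, gam A *ᵥ spinTerm (hatStructure C V dV a b da db) ψ A =
      (a : ℂ) • ∑ A, gam A *ᵥ spinTerm C ψ A
        + ∑ A, ((b * (eta A * V A) : ℝ) : ℂ) • gam A *ᵥ (∑ F, (V F : ℂ) • spinTerm C ψ F)
        + (1 / 2 : ℂ) • ∑ D, ((b * (eta D * V D) * expansion C V dV + b * acceleration C V dV D
          - ((3 * a + 2 * b) * (da D - eta D * V D * ∑ A, V A * da A)
            + a * (db D - eta D * V D * ∑ A, V A * db A)) / (a + b) : ℝ) : ℂ) • (gam D *ᵥ ψ)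
        + (Complex.I / 2 * b ^ 2 / (a + b)) • ∑ D, (w D : ℂ) • (gamLow D *ᵥ (gam5 *ᵥ ψ)) := by
  rw [sum_gam_spinTerm hhat, sum_gam_spinTerm hC, slash_spinTerm hC]
  simp only [trace_hatStructure hC hn ho ha hab hda, alt_hatStructure hC hab]
  have hw' : ∀ D, alt (fun A B E => eta A * V A *
          (eta B * dV B E - eta E * dV E B - velStructure C V B E)) D = 4 * w D :=
    fun D => by rw [hw]; ring
  simp only [hw']
  generalize alt C = X
  generalize hY : alt (fun A B E => b * (eta A * V A) * (∑ F, V F * conn C B E F) / 8) = Y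
  simp only [Finset.smul_sum, smul_smul, ← Finset.sum_add_distrib, ← Finset.sum_sub_distrib,
    smul_sub]
  refine Finset.sum_congr rfl fun D _ => ?_
  push_cast
  module

end Pointwise

/-! ### Derivatives of the currents and brackets of vector fields -/

/-- The real bilinear form `Re (Ψ̄ Q Φ)`. -/
def rePairing (Q : Matrix (Fin 4) (Fin 4) ℂ) : Spinor →ₗ[ℝ] Spinor →ₗ[ℝ] ℝ :=
  LinearMap.mk₂ ℝ (fun ψ φ => (star ψ ⬝ᵥ ((gam 0 * Q) *ᵥ φ)).re)
    (fun _ _ _ => by simp [add_dotProduct]) (fun _ _ _ => by simp [smul_dotProduct])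
    (fun _ _ _ => by simp [Matrix.mulVec_add, dotProduct_add])
    (fun _ _ _ => by simp [Matrix.mulVec_smul, dotProduct_smul])

theorem rePairing_apply (Q : Matrix (Fin 4) (Fin 4) ℂ) (ψ φ : Spinor) :
    rePairing Q ψ φ = (star ψ ⬝ᵥ ((gam 0 * Q) *ᵥ φ)).re := rfl

theorem rePairing_gam_comm (A : Fin 4) (ψ φ : Spinor) :
    rePairing (gam A) ψ φ = rePairing (gam A) φ ψ := by
  simp only [rePairing_apply, ← Matrix.mulVec_mulVec]
  fin_cases A <;> simp [gam_zero_mulVec, gam_one_mulVec, gam_two_mulVec,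
    gam_three_mulVec, dotProduct, Fin.sum_univ_four] <;> ring

theorem contDiff_bilin_re (Q : Matrix (Fin 4) (Fin 4) ℂ) {n : WithTop ℕ∞} :
    ContDiff ℝ n fun ψ => (bilin Q ψ).re := by
  have h := (rePairing Q).toContinuousBilinearMap.isBoundedBilinearMap.contDiff (n := n)
  exact h.comp (contDiff_id.prodMk contDiff_id)

theorem contDiff_current (A : Fin 4) {n : WithTop ℕ∞} : ContDiff ℝ n fun ψ => current ψ A :=
  contDiff_bilin_re _

theorem contDiff_currentSq {n : WithTop ℕ∞} : ContDiff ℝ n currentSq :=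
  ContDiff.sum fun A _ => contDiff_const.mul ((contDiff_current A).pow 2)

theorem contDiffAt_currentNorm {ψ : Spinor} (h : 0 < currentSq ψ) {n : WithTop ℕ∞} :
    ContDiffAt ℝ n currentNorm ψ :=
  contDiff_currentSq.contDiffAt.sqrt h.ne'

theorem currentNorm_pos {ψ : Spinor} (h : 0 < currentSq ψ) : 0 < currentNorm ψ :=
  Real.sqrt_pos.2 h

theorem contDiffAt_vel {ψ : Spinor} (h : 0 < currentSq ψ) (A : Fin 4) {n : WithTop ℕ∞} :
    ContDiffAt ℝ n (fun φ => vel φ A) ψ :=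
  (contDiff_current A).contDiffAt.div (contDiffAt_currentNorm h) (currentNorm_pos h).ne'

theorem fderiv_current (A : Fin 4) (ψ δ : Spinor) :
    fderiv ℝ (fun φ => current φ A) ψ δ = 2 * rePairing (gam A) ψ δ := by
  have h := (rePairing (gam A)).toContinuousBilinearMap.isBoundedBilinearMap.hasFDerivAt (ψ, ψ)
  have h' := HasFDerivAt.comp (f := fun φ : Spinor => (φ, φ)) ψ h
    ((hasFDerivAt_id ψ).prodMk (hasFDerivAt_id ψ))
  have h2 : fderiv ℝ (fun φ => current φ A) ψ = _ := h'.fderiv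
  rw [h2]
  change rePairing (gam A) ψ δ + rePairing (gam A) δ ψ = _
  rw [rePairing_gam_comm A δ ψ]; ring

theorem sum_eta_vel_sq {ψ : Spinor} (h : 0 < currentSq ψ) : ∑ A, eta A * vel ψ A ^ 2 = 1 := by
  have h2 : currentNorm ψ ^ 2 = currentSq ψ := Real.sq_sqrt h.le
  have h3 := (currentNorm_pos h).ne'
  simp only [vel, div_pow, h2, ← mul_div_assoc, ← Finset.sum_div]
  rw [← currentSq, div_self h.ne']

theorem current_eq {ψ : Spinor} (h : 0 < currentSq ψ) (A : Fin 4) :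
    current ψ A = currentNorm ψ * vel ψ A := by
  have h3 := (currentNorm_pos h).ne'
  rw [vel]; field_simp

section Geometry

variable {M : Type*} [TopologicalSpace M] [ChartedSpace (EuclideanSpace ℝ (Fin 4)) M]
variable {F G : Type*} [NormedAddCommGroup F] [NormedSpace ℝ F]
  [NormedAddCommGroup G] [NormedSpace ℝ G]
variable {X Y : ∀ p : M, TangentSpace (𝓡 4) p} {p : M}

theorem dirDeriv_comp {h : F → G} {f : M → F} (hh : DifferentiableAt ℝ h (f p))
    (hf : MDifferentiableAt (𝓡 4) 𝓘(ℝ, F) f p) :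
    dirDeriv X (fun q => h (f q)) p = fderiv ℝ h (f p) (dirDeriv X f p) := by
  have := mfderiv_comp_apply (I := 𝓡 4) (I' := 𝓘(ℝ, F)) (I'' := 𝓘(ℝ, G)) p
    hh.mdifferentiableAt hf (X p)
  rw [mfderiv_eq_fderiv] at this
  exact this

theorem dirDeriv_const (k : F) : dirDeriv X (fun _ => k) p = 0 := by
  simp only [dirDeriv, mfderiv_const]
  rfl

theorem dirDeriv_mul {f k : M → ℝ} (hf : MDifferentiableAt (𝓡 4) 𝓘(ℝ, ℝ) f p)
    (hk : MDifferentiableAt (𝓡 4) 𝓘(ℝ, ℝ) k p) :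
    dirDeriv X (fun q => f q * k q) p = f p * dirDeriv X k p + k p * dirDeriv X f p := by
  have h := congrArg (fun L => L (X p)) (mvfderiv_mul (I := 𝓡 4) hf hk)
  exact h

theorem dirDeriv_const_mul (c : ℝ) {k : M → ℝ} (hk : MDifferentiableAt (𝓡 4) 𝓘(ℝ, ℝ) k p) :
    dirDeriv X (fun q => c * k q) p = c * dirDeriv X k p := by
  have h := congrArg (fun L => L (X p))
    (mvfderiv_mul (I := 𝓡 4) (f := fun _ : M => c) mdifferentiableAt_const hk)
  rw [mvfderiv_const] at h
  simpa using! h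

theorem dirDeriv_smul_field_add (f k : ℝ) (f' : M → F) (p : M) {Z : ∀ p : M, TangentSpace (𝓡 4) p}
    (hZ : Z p = f • X p + k • Y p) :
    dirDeriv Z f' p = f • dirDeriv X f' p + k • dirDeriv Y f' p := by
  simp only [dirDeriv, hZ, map_add, map_smul]
  rfl

theorem dirDeriv_sum_smul (v : Fin 4 → ℝ) (e : Frame M) (f : M → F) (p : M)
    {Z : ∀ p : M, TangentSpace (𝓡 4) p} (hZ : Z p = ∑ A, v A • e A p) :
    dirDeriv Z f p = ∑ A, v A • dirDeriv (e A) f p := by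
  simp only [dirDeriv, hZ, map_sum, map_smul]
  rfl

/-- The bracket of two vector fields of the form of the disformal tetrad, a multiple of a frame
vector plus a multiple of a common field `Z`; the bracket of `Z` with itself does not appear. -/
theorem mlieBracket_smul_add_smul [IsManifold (𝓡 4) ∞ M] {f k f' k' : M → ℝ}
    {Z : ∀ p : M, TangentSpace (𝓡 4) p}
    (hf : MDifferentiableAt (𝓡 4) 𝓘(ℝ, ℝ) f p) (hk : MDifferentiableAt (𝓡 4) 𝓘(ℝ, ℝ) k p)
    (hf' : MDifferentiableAt (𝓡 4) 𝓘(ℝ, ℝ) f' p) (hk' : MDifferentiableAt (𝓡 4) 𝓘(ℝ, ℝ) k' p)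
    (hX : MDifferentiableAt (𝓡 4) (𝓡 4).tangent (fun q => (⟨q, X q⟩ : TangentBundle (𝓡 4) M)) p)
    (hY : MDifferentiableAt (𝓡 4) (𝓡 4).tangent (fun q => (⟨q, Y q⟩ : TangentBundle (𝓡 4) M)) p)
    (hZ : MDifferentiableAt (𝓡 4) (𝓡 4).tangent (fun q => (⟨q, Z q⟩ : TangentBundle (𝓡 4) M)) p) :
    VectorField.mlieBracket (𝓡 4) (fun q => f q • X q + k q • Z q)
        (fun q => f' q • Y q + k' q • Z q) p =
      (f p * f' p) • VectorField.mlieBracket (𝓡 4) X Y p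
      - (f p * k' p) • VectorField.mlieBracket (𝓡 4) Z X p
      + (k p * f' p) • VectorField.mlieBracket (𝓡 4) Z Y p
      + (f p * dirDeriv X f' p + k p * dirDeriv Z f' p) • Y p
      - (f' p * dirDeriv Y f p + k' p * dirDeriv Z f p) • X p
      + ((f p * dirDeriv X k' p + k p * dirDeriv Z k' p)
        - (f' p * dirDeriv Y k p + k' p * dirDeriv Z k p)) • Z p := by
  have : IsManifold (𝓡 4) 2 M := IsManifold.of_le (n := ∞) (WithTop.coe_le_coe.2 le_top)
  have e1 : (fun q => f q • X q + k q • Z q) = f • X + k • Z := rfl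
  have e2 : (fun q => f' q • Y q + k' q • Z q) = f' • Y + k' • Z := rfl
  have hd : ∀ (U : ∀ p : M, TangentSpace (𝓡 4) p) (u : M → ℝ),
    mvfderiv (𝓡 4) u p (U p) = dirDeriv U u p := fun _ _ => rfl
  rw [e1, e2, VectorField.mlieBracket_add_left (hf.smul_section hX) (hk.smul_section hZ),
    VectorField.mlieBracket_add_right (hf'.smul_section hY) (hk'.smul_section hZ),
    VectorField.mlieBracket_add_right (hf'.smul_section hY) (hk'.smul_section hZ),
    VectorField.mlieBracket_smul_left hf hX, VectorField.mlieBracket_smul_left hf hX,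
    VectorField.mlieBracket_smul_left hk hZ, VectorField.mlieBracket_smul_left hk hZ,
    VectorField.mlieBracket_smul_right hf' hY, VectorField.mlieBracket_smul_right hf' hY,
    VectorField.mlieBracket_smul_right hk' hZ, VectorField.mlieBracket_smul_right hk' hZ,
    VectorField.mlieBracket_self, VectorField.mlieBracket_swap_apply (V := X) (W := Z)]
  simp only [Pi.smul_apply', Pi.zero_apply, map_smul, hd]
  module

theorem mlieBracket_sum_smul_left [IsManifold (𝓡 4) ∞ M] {v : Fin 4 → M → ℝ} {e : Frame M}
    (hv : ∀ A, MDifferentiableAt (𝓡 4) 𝓘(ℝ, ℝ) (v A) p)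
    (he : ∀ A, MDifferentiableAt (𝓡 4) (𝓡 4).tangent
      (fun q => (⟨q, e A q⟩ : TangentBundle (𝓡 4) M)) p) :
    VectorField.mlieBracket (𝓡 4) (fun q => ∑ A, v A q • e A q) Y p =
      ∑ A, (v A p • VectorField.mlieBracket (𝓡 4) (e A) Y p - dirDeriv Y (v A) p • e A p) := by
  have : IsManifold (𝓡 4) 2 M := IsManifold.of_le (n := ∞) (WithTop.coe_le_coe.2 le_top)
  have e1 : (fun q => ∑ A, v A q • e A q) =
      v 0 • e 0 + v 1 • e 1 + v 2 • e 2 + v 3 • e 3 := by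
    funext q; simp [Fin.sum_univ_four]
  have hd : ∀ (U : ∀ p : M, TangentSpace (𝓡 4) p) (u : M → ℝ),
    mvfderiv (𝓡 4) u p (U p) = dirDeriv U u p := fun _ _ => rfl
  have hs := fun A => (hv A).smul_section (he A)
  rw [e1, VectorField.mlieBracket_add_left (mdifferentiableAt_add_section
      (mdifferentiableAt_add_section (hs 0) (hs 1)) (hs 2)) (hs 3),
    VectorField.mlieBracket_add_left (mdifferentiableAt_add_section (hs 0) (hs 1)) (hs 2),
    VectorField.mlieBracket_add_left (hs 0) (hs 1),
    VectorField.mlieBracket_smul_left (hv 0) (he 0),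
    VectorField.mlieBracket_smul_left (hv 1) (he 1),
    VectorField.mlieBracket_smul_left (hv 2) (he 2),
    VectorField.mlieBracket_smul_left (hv 3) (he 3),
    Fin.sum_univ_four]
  simp only [hd]
  module

end Geometry

/-! ### The disformal metric and its tetrad -/

section Geometry

variable {M : Type*} [TopologicalSpace M] [ChartedSpace (EuclideanSpace ℝ (Fin 4)) M]
variable {n : ℕ∞} {g : FormField M} {e : Frame M} {α β : M → ℝ} {Ψ : M → Spinor}

theorem form_velField (p : M) (X : TangentSpace (𝓡 4) p) :
    g p (velField e Ψ p) X = ∑ A, vel (Ψ p) A * g p (e A p) X := by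
  simp [velField]

theorem disformal_apply (p : M) (X Y : TangentSpace (𝓡 4) p) :
    disformal g e α β Ψ p X Y = (1 / α p) * g p X Y - (β p / (α p * (α p + β p))) *
      (g p (velField e Ψ p) X * g p (velField e Ψ p) Y) := rfl

theorem contMDiff_sqrt {f : M → ℝ} (hf : ContMDiff (𝓡 4) 𝓘(ℝ, ℝ) (n : WithTop ℕ∞) f)
    (h : ∀ p, 0 < f p) : ContMDiff (𝓡 4) 𝓘(ℝ, ℝ) (n : WithTop ℕ∞) fun p => √(f p) := fun p =>
  (Real.contDiffAt_sqrt (h p).ne').contMDiffAt.comp p (hf p)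

theorem contMDiff_inv {f : M → ℝ} (hf : ContMDiff (𝓡 4) 𝓘(ℝ, ℝ) (n : WithTop ℕ∞) f)
    (h : ∀ p, 0 < f p) : ContMDiff (𝓡 4) 𝓘(ℝ, ℝ) (n : WithTop ℕ∞) fun p => (f p)⁻¹ := fun p =>
  (contDiffAt_inv ℝ (h p).ne').contMDiffAt.comp p (hf p)

variable [IsManifold (𝓡 4) ∞ M]

theorem IsTetrad.linearIndependent (h : IsTetrad n g e) (p : M) :
    LinearIndependent ℝ fun A => e A p := by
  rw [Fintype.linearIndependent_iff]
  intro c hc B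
  have h1 : g p (∑ A, c A • e A p) (e B p) = c B * eta B := by
    rw [map_sum, LinearMap.sum_apply, Finset.sum_eq_single B]
    · simp [h.orthonormal]
    · intro A _ hAB
      simp [h.orthonormal, hAB]
    · simp
  rw [hc] at h1
  have h2 : c B * eta B = 0 := by rw [← h1]; simp
  have h3 := eta_mul_eta B
  calc c B = c B * eta B * eta B := by rw [mul_assoc, h3, mul_one]
    _ = 0 := by rw [h2, zero_mul]

/-- Orthonormality with respect to the nondegenerate `η` already makes a tetrad a basis. -/
theorem IsTetrad.exists_basis (h : IsTetrad n g e) (p : M) :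
    ∃ v : Module.Basis (Fin 4) ℝ (TangentSpace (𝓡 4) p),
      ∀ A B, g p (v A) (v B) = if A = B then eta A else 0 := by
  have hd : Fintype.card (Fin 4) = Module.finrank ℝ (TangentSpace (𝓡 4) p) := by
    change _ = Module.finrank ℝ (EuclideanSpace ℝ (Fin 4))
    simp
  have : Nonempty (Fin 4) := ⟨0⟩
  refine ⟨basisOfLinearIndependentOfCardEqFinrank (h.linearIndependent p) hd, fun A B => ?_⟩
  simp only [coe_basisOfLinearIndependentOfCardEqFinrank]
  exact h.orthonormal p A B

theorem sum_vel_velLow {ψ : Spinor} (h : 0 < currentSq ψ) : ∑ A, vel ψ A * velLow ψ A = 1 := by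
  rw [← sum_eta_vel_sq h]
  refine Finset.sum_congr rfl fun A _ => ?_
  rw [velLow]; ring

theorem IsTetrad.form_frame_velField (h : IsTetrad n g e) (p : M) (A : Fin 4) :
    g p (e A p) (velField e Ψ p) = velLow (Ψ p) A := by
  simp [velField, h.orthonormal, velLow, mul_comm]

theorem IsTetrad.form_velField_frame (h : IsTetrad n g e) (p : M) (A : Fin 4) :
    g p (velField e Ψ p) (e A p) = velLow (Ψ p) A := by
  simp [form_velField, h.orthonormal, velLow, mul_comm]

theorem IsSetting.form_velField_velField (h : IsSetting n g e α β Ψ) (p : M) :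
    g p (velField e Ψ p) (velField e Ψ p) = 1 := by
  rw [form_velField, ← sum_vel_velLow (h.timelike p)]
  simp only [h.tetrad.form_frame_velField]

theorem IsSetting.contMDiff_vel (h : IsSetting n g e α β Ψ) (A : Fin 4) :
    ContMDiff (𝓡 4) 𝓘(ℝ, ℝ) (n : WithTop ℕ∞) fun p => vel (Ψ p) A := fun p =>
  (contDiffAt_vel (h.timelike p) A).contMDiffAt.comp p (h.regular_spinor p)

theorem IsSetting.contMDiff_velLow (h : IsSetting n g e α β Ψ) (A : Fin 4) :
    ContMDiff (𝓡 4) 𝓘(ℝ, ℝ) (n : WithTop ℕ∞) fun p => velLow (Ψ p) A :=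
  contMDiff_const.mul (h.contMDiff_vel A)

theorem IsSetting.contMDiff_coefA (h : IsSetting n g e α β Ψ) :
    ContMDiff (𝓡 4) 𝓘(ℝ, ℝ) (n : WithTop ℕ∞) (coefA α) :=
  contMDiff_sqrt h.regular_alpha h.alpha_pos

theorem IsSetting.contMDiff_coefB (h : IsSetting n g e α β Ψ) :
    ContMDiff (𝓡 4) 𝓘(ℝ, ℝ) (n : WithTop ℕ∞) (coefB α β) :=
  (contMDiff_sqrt (h.regular_alpha.add h.regular_beta) h.add_pos).sub
    (contMDiff_sqrt h.regular_alpha h.alpha_pos)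

theorem IsSetting.isVectorField_velField (h : IsSetting n g e α β Ψ) :
    IsVectorField n (velField e Ψ) :=
  ContMDiff.sum_section fun A _ => (h.contMDiff_vel A).smul_section (h.tetrad.regular A)

theorem IsSetting.coefA_pos (h : IsSetting n g e α β Ψ) (p : M) : 0 < coefA α p :=
  Real.sqrt_pos.2 (h.alpha_pos p)

theorem IsSetting.coefA_add_coefB_pos (h : IsSetting n g e α β Ψ) (p : M) :
    0 < coefA α p + coefB α β p := by
  simpa [coefA, coefB] using h.add_pos p

theorem IsSetting.coefA_sq (h : IsSetting n g e α β Ψ) (p : M) : α p = coefA α p ^ 2 :=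
  (Real.sq_sqrt (h.alpha_pos p).le).symm

theorem IsSetting.coefA_add_coefB_sq (h : IsSetting n g e α β Ψ) (p : M) :
    α p + β p = (coefA α p + coefB α β p) ^ 2 := by
  simp [coefA, coefB, Real.sq_sqrt (h.add_pos p).le]

/-- The dual coframe of the disformal tetrad: `ĝ(ê_A, ·) = g(a⁻¹ e_A - b (a(a+b))⁻¹ V_A V, ·)`. -/
theorem IsSetting.disformal_disformalTetrad (h : IsSetting n g e α β Ψ) (p : M) (A : Fin 4)
    (X : TangentSpace (𝓡 4) p) :
    disformal g e α β Ψ p (disformalTetrad e α β Ψ A p) X =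
      (coefA α p)⁻¹ * g p (e A p) X
        - coefB α β p * (coefA α p)⁻¹ * (coefA α p + coefB α β p)⁻¹ * velLow (Ψ p) A *
          g p (velField e Ψ p) X := by
  have h1 := (h.coefA_pos p).ne'
  have h2 := (h.coefA_add_coefB_pos p).ne'
  have hβ : β p = (coefA α p + coefB α β p) ^ 2 - coefA α p ^ 2 := by
    rw [← h.coefA_add_coefB_sq, ← h.coefA_sq]; ring
  rw [disformal_apply, h.coefA_add_coefB_sq p, h.coefA_sq p, hβ]
  generalize hG : g p (velField e Ψ p) X = G
  have e1 : g p (disformalTetrad e α β Ψ A p) X =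
      coefA α p * g p (e A p) X + coefB α β p * velLow (Ψ p) A * G := by
    rw [← hG]; simp [disformalTetrad]
  have e2 : g p (velField e Ψ p) (disformalTetrad e α β Ψ A p) =
      (coefA α p + coefB α β p) * velLow (Ψ p) A := by
    simp only [disformalTetrad, map_add, map_smul, smul_eq_mul, h.tetrad.form_velField_frame,
      h.form_velField_velField]
    ring
  rw [e1, e2]
  generalize coefA α p = a at *
  generalize coefB α β p = b at *
  field_simp
  ring

theorem IsSetting.isTetrad_disformal (h : IsSetting n g e α β Ψ) :
    IsTetrad n (disformal g e α β Ψ) (disformalTetrad e α β Ψ) where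
  regular A := ContMDiff.add_section (h.contMDiff_coefA.smul_section (h.tetrad.regular A))
    ((h.contMDiff_coefB.mul (h.contMDiff_velLow A)).smul_section h.isVectorField_velField)
  orthonormal p A B := by
    have h1 := (h.coefA_pos p).ne'
    have h2 := (h.coefA_add_coefB_pos p).ne'
    rw [h.disformal_disformalTetrad]
    simp only [disformalTetrad, map_add, map_smul, smul_eq_mul, h.tetrad.form_velField_frame,
      h.form_velField_velField, h.tetrad.form_frame_velField, h.tetrad.orthonormal]
    field_simp
    ring

theorem IsSetting.isLorentzMetric_disformal (h : IsSetting n g e α β Ψ) :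
    IsLorentzMetric n (disformal g e α β Ψ) where
  symm p X Y := by
    rw [disformal_apply, disformal_apply, h.metric.symm p X Y]; ring
  signature p := h.isTetrad_disformal.exists_basis p
  regular X Y hX hY := by
    have hV := h.isVectorField_velField
    have h1 := contMDiff_inv h.regular_alpha h.alpha_pos
    have h2 := contMDiff_inv (h.regular_alpha.mul (h.regular_alpha.add h.regular_beta))
      fun p => mul_pos (h.alpha_pos p) (h.add_pos p)
    have h3 := (h1.mul (h.metric.regular X Y hX hY)).sub ((h.regular_beta.mul h2).mul
      ((h.metric.regular _ X hV hX).mul (h.metric.regular _ Y hV hY)))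
    refine h3.congr fun p => ?_
    rw [disformal_apply, one_div, div_eq_mul_inv]
    rfl

theorem IsSetting.disformal_mul_inverse (h : IsSetting n g e α β Ψ) (p : M) :
    (Matrix.of fun A B => disformal g e α β Ψ p (e A p) (e B p)) *
      (Matrix.of fun A B => α p * (if A = B then eta A else 0)
        + β p * (vel (Ψ p) A * vel (Ψ p) B)) = 1 := by
  have h1 := (h.alpha_pos p).ne'
  have h2 := (h.add_pos p).ne'
  ext A B
  have key : ∀ D, disformal g e α β Ψ p (e A p) (e D p) * (α p * (if D = B then eta D else 0)
      + β p * (vel (Ψ p) D * vel (Ψ p) B)) =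
      (if D = B then (if A = D then 1 else 0) else 0)
      + (if A = D then β p / α p * velLow (Ψ p) A * vel (Ψ p) B else 0)
      - (if D = B then β p / (α p + β p) * velLow (Ψ p) A * vel (Ψ p) B else 0)
      - β p * β p / (α p * (α p + β p)) * velLow (Ψ p) A * vel (Ψ p) B *
        (vel (Ψ p) D * velLow (Ψ p) D) := by
    intro D
    have h3 := eta_mul_eta D
    rw [disformal_apply, h.tetrad.orthonormal, h.tetrad.form_velField_frame,
      h.tetrad.form_velField_frame]
    rcases mul_self_eq_one_iff.1 h3 with h4 | h4 <;> split_ifs <;> subst_vars <;>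
      simp only [velLow, h4] <;> field_simp <;> ring
  rw [Matrix.mul_apply]
  simp only [Matrix.of_apply, key, Finset.sum_add_distrib, Finset.sum_sub_distrib,
    Finset.sum_ite_eq, Finset.sum_ite_eq', Finset.mem_univ, if_true, ← Finset.mul_sum,
    sum_vel_velLow (h.timelike p), Matrix.one_apply]
  field_simp
  ring

end Geometry

/-! ### The disformal structure functions -/

section Geometry

variable {M : Type*} [TopologicalSpace M] [ChartedSpace (EuclideanSpace ℝ (Fin 4)) M]
variable {n : ℕ∞} {g : FormField M} {e : Frame M} {α β : M → ℝ} {Ψ : M → Spinor}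

theorem structureFn_antisymm (p : M) (A B D : Fin 4) :
    structureFn g e A B D p = -structureFn g e A D B p := by
  rw [structureFn, VectorField.mlieBracket_swap_apply, map_neg, structureFn]

theorem nablaSpinor_eq (p : M) (A : Fin 4) :
    nablaSpinor g e Ψ A p =
      dirDeriv (e A) Ψ p + spinTerm (fun A B D => structureFn g e A B D p) (Ψ p) A := rfl

variable [IsManifold (𝓡 4) ∞ M]

/-- `V` has unit norm near a spinor with time-like current, so its variations are
orthogonal to it. -/
theorem sum_eta_vel_fderiv {ψ : Spinor} (h : 0 < currentSq ψ) (δ : Spinor) :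
    ∑ A, eta A * vel ψ A * fderiv ℝ (fun φ => vel φ A) ψ δ = 0 := by
  have h1 : ∀ A, HasFDerivAt (fun φ => vel φ A) (fderiv ℝ (fun φ => vel φ A) ψ) ψ := fun A =>
    ((contDiffAt_vel h A (n := 1)).differentiableAt one_ne_zero).hasFDerivAt
  have h2 : HasFDerivAt (fun φ => ∑ A, eta A * vel φ A ^ 2) _ ψ :=
    HasFDerivAt.fun_sum fun A _ => ((h1 A).pow 2).const_mul (eta A)
  have h3 : (fun φ => ∑ A, eta A * vel φ A ^ 2) =ᶠ[nhds ψ] fun _ => (1 : ℝ) := by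
    filter_upwards [contDiff_currentSq (n := 0) |>.continuous.continuousAt.eventually
      (lt_mem_nhds h)] with φ hφ using sum_eta_vel_sq hφ
  have h4 := h2.unique ((hasFDerivAt_const (1 : ℝ) ψ).congr_of_eventuallyEq h3)
  have h5 := congrArg (fun L => L δ) h4
  simp only [sum_apply, zero_apply] at h5
  have h6 : ∑ A, eta A * vel ψ A * fderiv ℝ (fun φ => vel φ A) ψ δ = 0 / 2 := by
    rw [← h5, Finset.sum_div]
    refine Finset.sum_congr rfl fun A _ => ?_
    simp
    ring
  simpa using h6

theorem IsSetting.mdifferentiableAt_spinor (h : IsSetting n g e α β Ψ) (hn : n ≠ 0) (p : M) :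
    MDifferentiableAt (𝓡 4) 𝓘(ℝ, Spinor) Ψ p :=
  h.regular_spinor.mdifferentiable (by exact_mod_cast hn) p

theorem IsSetting.mdifferentiableAt_vel (h : IsSetting n g e α β Ψ) (hn : n ≠ 0) (p : M)
    (A : Fin 4) : MDifferentiableAt (𝓡 4) 𝓘(ℝ, ℝ) (fun q => vel (Ψ q) A) p :=
  (h.contMDiff_vel A).mdifferentiable (by exact_mod_cast hn) p

theorem IsSetting.mdifferentiableAt_velLow (h : IsSetting n g e α β Ψ) (hn : n ≠ 0) (p : M)
    (A : Fin 4) : MDifferentiableAt (𝓡 4) 𝓘(ℝ, ℝ) (fun q => velLow (Ψ q) A) p :=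
  (h.contMDiff_velLow A).mdifferentiable (by exact_mod_cast hn) p

theorem IsSetting.mdifferentiableAt_coefA (h : IsSetting n g e α β Ψ) (hn : n ≠ 0) (p : M) :
    MDifferentiableAt (𝓡 4) 𝓘(ℝ, ℝ) (coefA α) p :=
  h.contMDiff_coefA.mdifferentiable (by exact_mod_cast hn) p

theorem IsSetting.mdifferentiableAt_coefB (h : IsSetting n g e α β Ψ) (hn : n ≠ 0) (p : M) :
    MDifferentiableAt (𝓡 4) 𝓘(ℝ, ℝ) (coefB α β) p :=
  h.contMDiff_coefB.mdifferentiable (by exact_mod_cast hn) p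

theorem IsVectorField.mdifferentiableAt {X : ∀ p : M, TangentSpace (𝓡 4) p}
    (h : IsVectorField n X) (hn : n ≠ 0) (p : M) :
    MDifferentiableAt (𝓡 4) (𝓡 4).tangent (fun q => (⟨q, X q⟩ : TangentBundle (𝓡 4) M)) p :=
  ContMDiff.mdifferentiable h (by exact_mod_cast hn) p

theorem IsSetting.sum_eta_vel_dirDeriv (h : IsSetting n g e α β Ψ) (hn : n ≠ 0) (p : M)
    (X : ∀ p : M, TangentSpace (𝓡 4) p) :
    ∑ A, eta A * vel (Ψ p) A * dirDeriv X (fun q => vel (Ψ q) A) p = 0 := by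
  rw [← sum_eta_vel_fderiv (h.timelike p) (dirDeriv X Ψ p)]
  refine Finset.sum_congr rfl fun A _ => ?_
  rw [dirDeriv_comp (h := fun φ => vel φ A)
    ((contDiffAt_vel (h.timelike p) A (n := 1)).differentiableAt one_ne_zero)
    (h.mdifferentiableAt_spinor hn p)]

theorem IsSetting.dirDeriv_velLow (h : IsSetting n g e α β Ψ) (hn : n ≠ 0) (p : M)
    (X : ∀ p : M, TangentSpace (𝓡 4) p) (A : Fin 4) :
    dirDeriv X (fun q => velLow (Ψ q) A) p = eta A * dirDeriv X (fun q => vel (Ψ q) A) p :=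
  dirDeriv_const_mul (eta A) (h.mdifferentiableAt_vel hn p A)

theorem IsSetting.form_bracket_velField (h : IsSetting n g e α β Ψ) (hn : n ≠ 0) (p : M)
    (A B : Fin 4) :
    g p (e A p) (VectorField.mlieBracket (𝓡 4) (velField e Ψ) (e B) p) =
      velBracket (fun A B D => structureFn g e A B D p) (vel (Ψ p))
        (fun A B => dirDeriv (e B) (fun q => vel (Ψ q) A) p) A B := by
  have h1 : velField e Ψ = fun q => ∑ A, vel (Ψ q) A • e A q := rfl
  rw [h1, mlieBracket_sum_smul_left (fun A => h.mdifferentiableAt_vel hn p A)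
    (fun A => (h.tetrad.regular A).mdifferentiableAt hn p)]
  simp only [map_sum, map_sub, map_smul, smul_eq_mul, h.tetrad.orthonormal, mul_ite, mul_zero,
    Finset.sum_sub_distrib, Finset.sum_ite_eq, Finset.mem_univ, if_true, velBracket]
  rw [mul_comm (eta A)]
  rfl

/-- The structure functions of the disformal tetrad in the disformal metric. -/
theorem IsSetting.structureFn_disformal (h : IsSetting n g e α β Ψ) (hn : n ≠ 0) (p : M)
    (A B D : Fin 4) :
    structureFn (disformal g e α β Ψ) (disformalTetrad e α β Ψ) A B D p =
      hatStructure (fun A B D => structureFn g e A B D p) (vel (Ψ p))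
        (fun A B => dirDeriv (e B) (fun q => vel (Ψ q) A) p) (coefA α p) (coefB α β p)
        (fun D => dirDeriv (e D) (coefA α) p) (fun D => dirDeriv (e D) (coefB α β) p) A B D := by
  have h1 := (h.coefA_pos p).ne'
  have h2 := (h.coefA_add_coefB_pos p).ne'
  have hk := fun A => (h.mdifferentiableAt_coefB hn p).mul (h.mdifferentiableAt_velLow hn p A)
  have hbr := mlieBracket_smul_add_smul (h.mdifferentiableAt_coefA hn p) (hk D)
    (h.mdifferentiableAt_coefA hn p) (hk B) ((h.tetrad.regular D).mdifferentiableAt hn p)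
    ((h.tetrad.regular B).mdifferentiableAt hn p) (h.isVectorField_velField.mdifferentiableAt hn p)
  have hd : ∀ (X : ∀ p : M, TangentSpace (𝓡 4) p) (A : Fin 4),
      dirDeriv X (coefB α β * fun q => velLow (Ψ q) A) p =
        coefB α β p * (eta A * dirDeriv X (fun q => vel (Ψ q) A) p)
          + velLow (Ψ p) A * dirDeriv X (coefB α β) p := by
    intro X A
    rw [← h.dirDeriv_velLow hn p X A]
    exact dirDeriv_mul (h.mdifferentiableAt_coefB hn p) (h.mdifferentiableAt_velLow hn p A)
  have hV : ∀ f : M → ℝ, dirDeriv (velField e Ψ) f p = ∑ A, vel (Ψ p) A * dirDeriv (e A) f p :=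
    fun f => dirDeriv_sum_smul (vel (Ψ p)) e f p rfl
  have hg1 : ∀ A B D, g p (e A p) (VectorField.mlieBracket (𝓡 4) (e D) (e B) p) =
      structureFn g e A B D p := fun _ _ _ => rfl
  have hg2 : ∀ B D, g p (velField e Ψ p) (VectorField.mlieBracket (𝓡 4) (e D) (e B) p) =
      velStructure (fun A B D => structureFn g e A B D p) (vel (Ψ p)) B D := fun B D => by
    rw [form_velField]; rfl
  have hg3 : ∀ B, g p (velField e Ψ p) (VectorField.mlieBracket (𝓡 4) (velField e Ψ) (e B) p) =
      velVelBracket (fun A B D => structureFn g e A B D p) (vel (Ψ p))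
        (fun A B => dirDeriv (e B) (fun q => vel (Ψ q) A) p) B := fun B => by
    rw [form_velField]
    simp only [h.form_bracket_velField hn]
    rfl
  have hY : ∀ A, velAlong (vel (Ψ p)) (fun A B => dirDeriv (e B) (fun q => vel (Ψ q) A) p) A =
      eta A * ∑ B, vel (Ψ p) B * dirDeriv (e B) (fun q => vel (Ψ q) A) p := fun _ => rfl
  have e1 : ∀ A, disformalTetrad e α β Ψ A = fun q => coefA α q • e A q +
      (coefB α β * fun q => velLow (Ψ q) A) q • velField e Ψ q := fun _ => rfl
  rw [structureFn, h.disformal_disformalTetrad, e1 D, e1 B]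
  refine (congrArg₂ (fun x y => (coefA α p)⁻¹ * x - coefB α β p * (coefA α p)⁻¹ *
    (coefA α p + coefB α β p)⁻¹ * velLow (Ψ p) A * y) (congrArg (g p (e A p)) hbr)
    (congrArg (g p (velField e Ψ p)) hbr)).trans ?_
  simp only [map_add, map_sub, map_smul, smul_eq_mul, hg1, hg2, hg3, h.form_bracket_velField hn,
    h.tetrad.orthonormal, h.tetrad.form_frame_velField, h.tetrad.form_velField_frame,
    h.form_velField_velField, hd, Pi.mul_apply]
  simp only [hV, hatStructure, hY, velLow]
  generalize velBracket _ _ _ = W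
  generalize velVelBracket _ _ _ = U
  generalize velStructure _ _ = X
  generalize coefA α p = a at *
  generalize coefB α β p = b at *
  generalize (∑ E, vel (Ψ p) E * dirDeriv (e E) (coefA α) p) = s1
  generalize (∑ E, vel (Ψ p) E * dirDeriv (e E) (coefB α β) p) = s2
  generalize (if A = B then eta A else 0) = i1
  generalize (if A = D then eta A else 0) = i2
  field_simp
  ring

end Geometry

/-! ### Spinor algebra of the generalized Inomata condition -/

/-- The Feynman slash `v̸ = v^C γ_C`. -/
def slash (v : Fin 4 → ℝ) : Matrix (Fin 4) (Fin 4) ℂ := ∑ C, (v C : ℂ) • gamLow C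

theorem slash_mulVec (v : Fin 4 → ℝ) (φ : Spinor) :
    slash v *ᵥ φ = ∑ C, (v C : ℂ) • (gamLow C *ᵥ φ) := by
  rw [slash, Matrix.sum_mulVec]
  simp only [Matrix.smul_mulVec]

theorem sum_eta_smul_gam_mulVec (v : Fin 4 → ℝ) (φ : Spinor) :
    ∑ C, ((eta C * v C : ℝ) : ℂ) • (gam C *ᵥ φ) = slash v *ᵥ φ := by
  rw [slash_mulVec]
  refine Finset.sum_congr rfl fun C _ => ?_
  rw [gamLow, Matrix.smul_mulVec, smul_smul]
  congr 1
  push_cast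
  ring

theorem gamLow_gam5_mulVec (A : Fin 4) (ψ : Spinor) :
    gamLow A *ᵥ (gam5 *ᵥ ψ) = -(gam5 *ᵥ (gamLow A *ᵥ ψ)) := by
  simp only [gamLow, Matrix.smul_mulVec, gam_gam5_mulVec, Matrix.mulVec_smul, smul_neg]

theorem slash_gam5_mulVec (v : Fin 4 → ℝ) (ψ : Spinor) :
    slash v *ᵥ (gam5 *ᵥ ψ) = -(gam5 *ᵥ (slash v *ᵥ ψ)) := by
  simp only [slash_mulVec, gamLow_gam5_mulVec, Matrix.mulVec_sum, Matrix.mulVec_smul, smul_neg,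
    Finset.sum_neg_distrib]

theorem slash_slash_mulVec (v : Fin 4 → ℝ) (ψ : Spinor) :
    slash v *ᵥ (slash v *ᵥ ψ) = ((∑ A, eta A * v A ^ 2 : ℝ) : ℂ) • ψ := by
  have h := sum_slash_sq (fun A => eta A * v A) ψ
  rw [← sum_eta_smul_gam_mulVec v (slash v *ᵥ ψ), ← sum_eta_smul_gam_mulVec v ψ]
  have h1 : ∀ A, eta A * (eta A * v A) ^ 2 = eta A * v A ^ 2 := fun A => by
    linear_combination (eta A * v A ^ 2) * eta_mul_eta A
  simp only [h1] at h
  rw [← h]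
  refine Finset.sum_congr rfl fun A _ => ?_
  rw [Matrix.mulVec_sum, Finset.smul_sum]
  refine Finset.sum_congr rfl fun B _ => ?_
  rw [Matrix.mulVec_smul, smul_smul]
  push_cast
  rfl

theorem slash_vel_mulVec (ψ : Spinor) :
    slash (vel ψ) *ᵥ ψ = (currentNorm ψ : ℂ)⁻¹ •
      ((scalarA ψ : ℂ) • ψ + (Complex.I * scalarB ψ) • (gam5 *ᵥ ψ)) := by
  rw [← currentSlash_mulVec, ← sum_eta_smul_gam_mulVec, Finset.smul_sum]
  refine Finset.sum_congr rfl fun A _ => ?_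
  rw [smul_smul, vel]
  congr 1
  push_cast
  ring

section Pointwise

variable {ψ : Spinor} {N : Fin 4 → Spinor} {m : ℝ} {w : Fin 4 → ℝ} {s₀ s₁ s₂ : ℂ}

/-- The right-hand side of the generalized Inomata condition with `s₃ = -4 s₁`, `s₄ = -4 s₂`,
with the matrix products carried out. -/
def inomataForm (m : ℝ) (ψ : Spinor) (w : Fin 4 → ℝ) (s₀ s₁ s₂ : ℂ) (B : Fin 4) : Spinor :=
  (velLow ψ B : ℂ) •
      (s₀ • ψ - (m * scalarB ψ / (3 * currentNorm ψ) : ℂ) • (gam5 *ᵥ ψ))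
    - (1 / (4 * currentNorm ψ) : ℂ) •
      (((s₀ + Complex.I * m * scalarA ψ / currentNorm ψ) * scalarA ψ
          + (4 * m * scalarB ψ / (3 * currentNorm ψ)) * (Complex.I * scalarB ψ)) •
            (gamLow B *ᵥ ψ)
        - ((s₀ + Complex.I * m * scalarA ψ / currentNorm ψ) * (Complex.I * scalarB ψ)
          + (4 * m * scalarB ψ / (3 * currentNorm ψ)) * scalarA ψ) •
            (gam5 *ᵥ (gamLow B *ᵥ ψ)))
    + gamLow B *ᵥ (slash w *ᵥ (s₁ • ψ + s₂ • (gam5 *ᵥ ψ)))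
    - (4 * (eta B * w B : ℝ) : ℂ) • (s₁ • ψ + s₂ • (gam5 *ᵥ ψ))

/-- The Fierz identity `A² + B² = J²` as an identity of complex numbers. -/
theorem ofReal_currentNorm_sq (h : 0 < currentSq ψ) :
    (scalarA ψ : ℂ) ^ 2 + (scalarB ψ : ℂ) ^ 2 = (currentNorm ψ : ℂ) ^ 2 := by
  have h2 : currentNorm ψ ^ 2 = currentSq ψ := Real.sq_sqrt h.le
  rw [currentSq_eq] at h2
  exact_mod_cast h2.symm

/-- The generalized Inomata condition determines `γ^B ∇_B Ψ`. The vorticity terms cancel because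
`γ^B γ_B = 4`, the terms in `s₀` because `V̸ Ψ = (A + i B γ₅) Ψ / √J²`, and what is left is the mass
term by `A² + B² = J²`. -/
theorem sum_gam_inomataForm (h : 0 < currentSq ψ) :
    ∑ B, gam B *ᵥ inomataForm m ψ w s₀ s₁ s₂ B = -(Complex.I * m) • ψ := by
  have hj : (currentNorm ψ : ℂ) ≠ 0 := by exact_mod_cast (currentNorm_pos h).ne'
  have h1 : ∀ φ, ∑ B, (velLow ψ B : ℂ) • (gam B *ᵥ φ) = slash (vel ψ) *ᵥ φ := fun φ =>
    sum_eta_smul_gam_mulVec _ _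
  have h2 : ∀ φ, ∑ B, (4 * (eta B * w B : ℝ) : ℂ) • (gam B *ᵥ φ) = (4 : ℂ) • (slash w *ᵥ φ) :=
    fun φ => by simp only [← sum_eta_smul_gam_mulVec, Finset.smul_sum, smul_smul]
  have h3 : ∑ B, gam B *ᵥ (gam5 *ᵥ (gamLow B *ᵥ ψ)) = -((4 : ℂ) • (gam5 *ᵥ ψ)) := by
    simp only [gam_gam5_mulVec, Finset.sum_neg_distrib, ← Matrix.mulVec_sum,
      sum_gam_gamLow_mulVec, Matrix.mulVec_smul]
  simp only [inomataForm, Matrix.mulVec_add, Matrix.mulVec_sub, Matrix.mulVec_smul,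
    Finset.sum_add_distrib, Finset.sum_sub_distrib, smul_sub, smul_add]
  simp only [smul_comm (velLow ψ _ : ℂ), smul_comm (4 * (eta _ * w _ : ℝ) : ℂ),
    ← Finset.smul_sum, h1, h2, h3, sum_gam_gamLow_mulVec, slash_gam5_mulVec,
    slash_vel_mulVec, Matrix.mulVec_add, Matrix.mulVec_smul, gam5_gam5_mulVec]
  match_scalars
  · field_simp
    linear_combination (-3 * m * Complex.I : ℂ) * ofReal_currentNorm_sq h
  · field_simp
    linear_combination (-3 * m * scalarA ψ * scalarB ψ : ℂ) * Complex.I_sq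
  · ring
  · ring

/-- The generalized Inomata condition determines `V̸ ∇_V Ψ`, for a vorticity vector `w`
orthogonal to `V`. -/
theorem slash_vel_sum_inomataForm (h : 0 < currentSq ψ)
    (hw : ∑ A, vel ψ A * (eta A * w A) = 0) :
    slash (vel ψ) *ᵥ (∑ F, (vel ψ F : ℂ) • inomataForm m ψ w s₀ s₁ s₂ F) =
      (3 / 4 * s₀ - Complex.I * m * scalarA ψ / (4 * currentNorm ψ)) • (slash (vel ψ) *ᵥ ψ)
        + slash w *ᵥ (s₁ • ψ + s₂ • (gam5 *ᵥ ψ)) := by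
  have hj : (currentNorm ψ : ℂ) ≠ 0 := by exact_mod_cast (currentNorm_pos h).ne'
  have h1 : ∀ φ, ∑ F, (vel ψ F : ℂ) • (gamLow F *ᵥ φ) = slash (vel ψ) *ᵥ φ := fun φ =>
    (slash_mulVec _ _).symm
  have h2 : ∀ φ : Spinor, ∑ F, (vel ψ F : ℂ) • (velLow ψ F : ℂ) • φ = φ := fun φ => by
    have : ∑ F, (vel ψ F : ℂ) * (velLow ψ F : ℂ) = 1 := by exact_mod_cast sum_vel_velLow h
    simp only [smul_smul, ← Finset.sum_smul, this, one_smul]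
  have h3 : ∀ φ : Spinor, ∑ F, (vel ψ F : ℂ) • (4 * (eta F * w F : ℝ) : ℂ) • φ = 0 := fun φ => by
    have : ∑ F, (vel ψ F : ℂ) * (eta F * w F : ℝ) = 0 := by exact_mod_cast hw
    simp only [smul_smul, mul_left_comm _ (4 : ℂ), ← Finset.sum_smul, ← Finset.mul_sum, this,
      mul_zero, zero_smul]
  have h4 : ∑ F, (vel ψ F : ℂ) • inomataForm m ψ w s₀ s₁ s₂ F =
      (s₀ • ψ - (m * scalarB ψ / (3 * currentNorm ψ) : ℂ) • (gam5 *ᵥ ψ))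
      - (1 / (4 * currentNorm ψ) : ℂ) •
      (((s₀ + Complex.I * m * scalarA ψ / currentNorm ψ) * scalarA ψ
          + (4 * m * scalarB ψ / (3 * currentNorm ψ)) * (Complex.I * scalarB ψ)) •
            (slash (vel ψ) *ᵥ ψ)
        - ((s₀ + Complex.I * m * scalarA ψ / currentNorm ψ) * (Complex.I * scalarB ψ)
          + (4 * m * scalarB ψ / (3 * currentNorm ψ)) * scalarA ψ) •
            (gam5 *ᵥ (slash (vel ψ) *ᵥ ψ)))
      + slash (vel ψ) *ᵥ (slash w *ᵥ (s₁ • ψ + s₂ • (gam5 *ᵥ ψ))) := by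
    simp only [inomataForm]
    generalize slash w *ᵥ (s₁ • ψ + s₂ • (gam5 *ᵥ ψ)) = φ
    generalize s₁ • ψ + s₂ • (gam5 *ᵥ ψ) = χ
    generalize hχ : s₀ • ψ - (m * scalarB ψ / (3 * currentNorm ψ) : ℂ) • (gam5 *ᵥ ψ) = χ'
    simp only [smul_add, smul_sub, Finset.sum_add_distrib, Finset.sum_sub_distrib, h2, h3,
      sub_zero]
    simp only [smul_comm (vel ψ _ : ℂ) (1 / (4 * currentNorm ψ) : ℂ),
      smul_comm (vel ψ _ : ℂ) (((s₀ + Complex.I * m * scalarA ψ / currentNorm ψ) * scalarA ψ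
          + (4 * m * scalarB ψ / (3 * currentNorm ψ)) * (Complex.I * scalarB ψ))),
      smul_comm (vel ψ _ : ℂ) ((s₀ + Complex.I * m * scalarA ψ / currentNorm ψ) *
        (Complex.I * scalarB ψ) + (4 * m * scalarB ψ / (3 * currentNorm ψ)) * scalarA ψ),
      ← Matrix.mulVec_smul gam5, ← Finset.smul_sum, ← Matrix.mulVec_sum, h1]
  have h5 := sum_eta_vel_sq h
  rw [h4]
  simp only [Matrix.mulVec_add, Matrix.mulVec_sub, Matrix.mulVec_smul, slash_gam5_mulVec,
    slash_slash_mulVec, h5, Complex.ofReal_one, one_smul]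
  simp only [slash_vel_mulVec, Matrix.mulVec_add, Matrix.mulVec_smul, gam5_gam5_mulVec]
  match_scalars
  · field_simp
    ring
  · field_simp
    ring
  · ring
  · ring

/-- `2 Re (Ψ̄ γ^A ∇_A Ψ)` is the divergence of the current: the zeroth-order part of `∇_A Ψ`
contributes the connection term of `∇_A J^A`, its axial part being imaginary. -/
theorem two_mul_sum_rePairing (C : Fin 4 → Fin 4 → Fin 4 → ℝ) (hC : ∀ A B D, C A B D = -C A D B)
    (δ : Fin 4 → Spinor) :
    2 * ∑ A, rePairing (gam A) ψ (δ A + spinTerm C ψ A) =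
      ∑ A, 2 * rePairing (gam A) ψ (δ A) + ∑ A, eta A * ∑ E, conn C A E A * current ψ E := by
  have h1 : ∑ A, rePairing (gam A) ψ (spinTerm C ψ A) =
      (star ψ ⬝ᵥ (gam 0 *ᵥ (∑ A, gam A *ᵥ spinTerm C ψ A))).re := by
    simp only [rePairing_apply, Matrix.mulVec_sum, dotProduct_sum, Complex.re_sum,
      Matrix.mulVec_mulVec]
  have h2 : ∀ D, star ψ ⬝ᵥ (gam 0 *ᵥ (gam D *ᵥ ψ)) = (current ψ D : ℂ) := fun D => by
    rw [ofReal_current, bilin_eq]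
  have h3 : ∀ D, star ψ ⬝ᵥ (gam 0 *ᵥ (gamLow D *ᵥ (gam5 *ᵥ ψ))) =
      ((eta D * axial ψ D : ℝ) : ℂ) := fun D => by
    rw [Complex.ofReal_mul, ofReal_axial, bilin_eq, gamLow, Matrix.smul_mulVec,
      Matrix.mulVec_smul, dotProduct_smul, ← Matrix.mulVec_mulVec, smul_eq_mul]
  have h4 : (star ψ ⬝ᵥ (gam 0 *ᵥ (∑ A, gam A *ᵥ spinTerm C ψ A))) =
      ((1 / 2 * ∑ D, (∑ A, eta A * C A D A) * current ψ D : ℝ) : ℂ)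
        - Complex.I * ((∑ D, alt C D * (eta D * axial ψ D) : ℝ) / 8 : ℝ) := by
    rw [sum_gam_spinTerm hC]
    simp only [Matrix.mulVec_sub, Matrix.mulVec_smul, Matrix.mulVec_sum, dotProduct_sub,
      dotProduct_smul, dotProduct_sum, h2, h3, smul_eq_mul]
    push_cast
    ring
  have h5 : ∑ D, (∑ A, eta A * C A D A) * current ψ D =
      ∑ A, eta A * ∑ E, conn C A E A * current ψ E := by
    simp only [Finset.sum_mul, Finset.mul_sum]
    rw [Finset.sum_comm]
    refine Finset.sum_congr rfl fun A _ => Finset.sum_congr rfl fun E _ => ?_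
    have h : C E A A = 0 := by linarith [hC E A A]
    rw [conn, hC A A E, h]; ring
  rw [← h5]
  simp only [map_add, Finset.sum_add_distrib, h1, h4, mul_add, ← Finset.mul_sum]
  simp

end Pointwise

/-! ### The Dirac equations in the two metrics -/

section Geometry

variable {M : Type*} [TopologicalSpace M] [ChartedSpace (EuclideanSpace ℝ (Fin 4)) M]
variable {n : ℕ∞} {g : FormField M} {e : Frame M} {α β : M → ℝ} {Ψ : M → Spinor}
  {m : ℝ} {s₀ s₁ s₂ : M → ℂ}

theorem inomataCondition_iff :
    InomataCondition g e m Ψ s₀ s₁ s₂ (fun p => -4 * s₁ p) (fun p => -4 * s₂ p) ↔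
      ∀ p B, nablaSpinor g e Ψ B p =
        inomataForm m (Ψ p) (fun C => vort g e Ψ C p) (s₀ p) (s₁ p) (s₂ p) B := by
  refine forall_congr' fun p => forall_congr' fun B => Eq.congr_right ?_
  have hs : vortSlash g e Ψ p = slash fun C => vort g e Ψ C p := rfl
  rw [inomataForm, hs, vortLow]
  simp only [Matrix.sub_mulVec, Matrix.add_mulVec, Matrix.smul_mulVec, Matrix.one_mulVec,
    ← Matrix.mulVec_mulVec, Matrix.mulVec_add, Matrix.mulVec_smul, Matrix.mulVec_sub,
    gam5_gam5_mulVec]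
  module

theorem sum_velLow_vort (p : M) : ∑ A, vel (Ψ p) A * (eta A * vort g e Ψ A p) = 0 := by
  simp only [vort, mul_assoc, sum_eps_right]
  simp only [alt, velLow, Fin.sum_univ_four]
  simp
  ring_nf

variable [IsManifold (𝓡 4) ∞ M]

theorem IsSetting.diracEquation_of_inomata (h : IsSetting n g e α β Ψ)
    (hI : InomataCondition g e m Ψ s₀ s₁ s₂ (fun p => -4 * s₁ p) (fun p => -4 * s₂ p)) :
    DiracEquation g e (fun _ => m) Ψ := by
  intro p
  simp only [inomataCondition_iff.1 hI, sum_gam_inomataForm (h.timelike p), smul_smul]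
  rw [← sub_smul]
  simp [← mul_assoc]

theorem IsSetting.nablaVel_eq (h : IsSetting n g e α β Ψ) (hn : n ≠ 0) (p : M) (B D : Fin 4) :
    nablaVel g e Ψ B D p = eta B * dirDeriv (e D) (fun q => vel (Ψ q) B) p
      + ∑ E, conn (fun A B D => structureFn g e A B D p) B E D * vel (Ψ p) E := by
  rw [nablaVel, h.dirDeriv_velLow hn]; rfl

theorem IsSetting.accel_eq (h : IsSetting n g e α β Ψ) (hn : n ≠ 0) (p : M) (A : Fin 4) :
    accel g e Ψ A p = acceleration (fun A B D => structureFn g e A B D p) (vel (Ψ p))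
      (fun A B => dirDeriv (e B) (fun q => vel (Ψ q) A) p) A := by
  simp only [accel, h.nablaVel_eq hn, acceleration]

theorem IsSetting.nablaVel_sub_nablaVel (h : IsSetting n g e α β Ψ) (hn : n ≠ 0) (p : M)
    (B D : Fin 4) :
    nablaVel g e Ψ B D p - nablaVel g e Ψ D B p =
      eta B * dirDeriv (e D) (fun q => vel (Ψ q) B) p
        - eta D * dirDeriv (e B) (fun q => vel (Ψ q) D) p
        - velStructure (fun A B D => structureFn g e A B D p) (vel (Ψ p)) B D := by
  have h1 : ∑ E, conn (fun A B D => structureFn g e A B D p) B E D * vel (Ψ p) E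
      - ∑ E, conn (fun A B D => structureFn g e A B D p) D E B * vel (Ψ p) E =
      -velStructure (fun A B D => structureFn g e A B D p) (vel (Ψ p)) B D := by
    rw [velStructure, ← Finset.sum_sub_distrib, ← Finset.sum_neg_distrib]
    refine Finset.sum_congr rfl fun E _ => ?_
    simp only [conn]
    rw [structureFn_antisymm p B E D, structureFn_antisymm p D E B, structureFn_antisymm p E D B]
    ring
  rw [h.nablaVel_eq hn, h.nablaVel_eq hn]
  linear_combination h1

/-- In the vorticity vector the projectors can be dropped, and `∇_E V_D - ∇_D V_E` is the
curl of `V` in the tetrad. -/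
theorem IsSetting.vort_eq (h : IsSetting n g e α β Ψ) (hn : n ≠ 0) (p : M) (A : Fin 4) :
    vort g e Ψ A p = alt (fun A B E => eta A * vel (Ψ p) A *
      (eta B * dirDeriv (e E) (fun q => vel (Ψ q) B) p
        - eta E * dirDeriv (e B) (fun q => vel (Ψ q) E) p
        - velStructure (fun A B D => structureFn g e A B D p) (vel (Ψ p)) B E)) A / 4 := by
  have h1 := alt_proj (velLow (Ψ p)) (vel (Ψ p)) (fun B D => nablaVel g e Ψ B D p) A
  simp only [h.nablaVel_sub_nablaVel hn] at h1
  simp only [vort, mul_assoc, sum_eps_right]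
  simp only [vortTensor, proj, h.nablaVel_sub_nablaVel hn, h1]
  simp only [velLow]
  ring_nf

/-- Conservation of the current of a solution of the Dirac equation, `∇_A (√J² V^A) = 0`, written
as a formula for the expansion of `V`. -/
theorem IsSetting.expansion_eq (h : IsSetting n g e α β Ψ) (hn : n ≠ 0)
    (hD : DiracEquation g e (fun _ => m) Ψ) (p : M) :
    expansion (fun A B D => structureFn g e A B D p) (vel (Ψ p))
        (fun A B => dirDeriv (e B) (fun q => vel (Ψ q) A) p) =
      -dot e Ψ (fun q => Real.log (currentNorm (Ψ q))) p := by
  have hC : ∀ A B D, structureFn g e A B D p = -structureFn g e A D B p := structureFn_antisymm p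
  have hj := currentNorm_pos (h.timelike p)
  have hd1 : DifferentiableAt ℝ currentNorm (Ψ p) :=
    (contDiffAt_currentNorm (h.timelike p) (n := 1)).differentiableAt one_ne_zero
  have hm := h.mdifferentiableAt_spinor hn p
  have hm1 : MDifferentiableAt (𝓡 4) 𝓘(ℝ, ℝ) (fun q => currentNorm (Ψ q)) p :=
    hd1.mdifferentiableAt.comp p hm
  have h1 := two_mul_sum_rePairing (ψ := Ψ p) (fun A B D => structureFn g e A B D p) hC
    fun A => dirDeriv (e A) Ψ p
  have h2 : ∑ A, rePairing (gam A) (Ψ p) (nablaSpinor g e Ψ A p) = 0 := by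
    have h3 : ∑ A, gam A *ᵥ nablaSpinor g e Ψ A p = -(Complex.I * m) • Ψ p := by
      have h4 := congrArg (fun φ => -Complex.I • φ) (hD p)
      simp only [smul_sub, smul_smul, neg_mul, Complex.I_mul_I, neg_neg, one_smul, smul_zero] at h4
      exact sub_eq_zero.1 h4
    have h5 : ∑ A, rePairing (gam A) (Ψ p) (nablaSpinor g e Ψ A p) =
        (star (Ψ p) ⬝ᵥ (gam 0 *ᵥ (∑ A, gam A *ᵥ nablaSpinor g e Ψ A p))).re := by
      simp only [rePairing_apply, Matrix.mulVec_sum, dotProduct_sum, Complex.re_sum,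
        Matrix.mulVec_mulVec]
    have h6 : star (Ψ p) ⬝ᵥ (gam 0 *ᵥ Ψ p) = (scalarA (Ψ p) : ℂ) := by
      rw [ofReal_scalarA, bilin_eq, Matrix.one_mulVec]
    rw [h5, h3, Matrix.mulVec_smul, dotProduct_smul, h6]
    simp
  have h7 : ∀ A, 2 * rePairing (gam A) (Ψ p) (dirDeriv (e A) Ψ p) =
      currentNorm (Ψ p) * dirDeriv (e A) (fun q => vel (Ψ q) A) p
        + vel (Ψ p) A * dirDeriv (e A) (fun q => currentNorm (Ψ q)) p := by
    intro A
    rw [← fderiv_current, ← dirDeriv_comp (h := fun φ => current φ A)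
      ((contDiff_current A (n := 1)).differentiable one_ne_zero _) hm]
    simp only [current_eq (h.timelike _)]
    exact dirDeriv_mul hm1 (h.mdifferentiableAt_vel hn p A)
  have h8 : ∀ A, dirDeriv (e A) (fun q => Real.log (currentNorm (Ψ q))) p =
      (currentNorm (Ψ p))⁻¹ * dirDeriv (e A) (fun q => currentNorm (Ψ q)) p := by
    intro A
    rw [dirDeriv_comp (h := Real.log) (f := fun q => currentNorm (Ψ q))
      (Real.differentiableAt_log hj.ne') hm1]
    rw [← toSpanSingleton_deriv]
    simp [mul_comm]
  simp only [nablaSpinor_eq] at h2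
  rw [h2] at h1
  simp only [h7, current_eq (h.timelike p)] at h1
  have h9 : currentNorm (Ψ p) * expansion (fun A B D => structureFn g e A B D p) (vel (Ψ p))
        (fun A B => dirDeriv (e B) (fun q => vel (Ψ q) A) p)
      + ∑ A, vel (Ψ p) A * dirDeriv (e A) (fun q => currentNorm (Ψ q)) p = 0 := by
    rw [mul_zero] at h1
    rw [h1, expansion, Finset.mul_sum, ← Finset.sum_add_distrib, ← Finset.sum_add_distrib]
    refine Finset.sum_congr rfl fun A _ => ?_
    have h10 : ∑ E, conn (fun A B D => structureFn g e A B D p) A E A *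
        (currentNorm (Ψ p) * vel (Ψ p) E) = currentNorm (Ψ p) *
        ∑ E, conn (fun A B D => structureFn g e A B D p) A E A * vel (Ψ p) E := by
      rw [Finset.mul_sum]
      exact Finset.sum_congr rfl fun E _ => by ring
    rw [h10]
    linear_combination (currentNorm (Ψ p) * dirDeriv (e A) (fun q => vel (Ψ q) A) p) *
      eta_mul_eta A
  have h11 : dot e Ψ (fun q => Real.log (currentNorm (Ψ q))) p = (currentNorm (Ψ p))⁻¹ *
      ∑ A, vel (Ψ p) A * dirDeriv (e A) (fun q => currentNorm (Ψ q)) p := by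
    rw [dot, Finset.mul_sum]
    exact Finset.sum_congr rfl fun A _ => by rw [h8]; ring
  rw [h11]
  field_simp
  linear_combination h9

/-- The Dirac operator of the disformal metric in terms of that of the target metric, for
`ȧ = 0`. -/
theorem IsSetting.sum_gam_nablaSpinor_disformal (h : IsSetting n g e α β Ψ) (hn : n ≠ 0) (p : M)
    (hda : dot e Ψ (coefA α) p = 0) :
    ∑ A, gam A *ᵥ nablaSpinor (disformal g e α β Ψ) (disformalTetrad e α β Ψ) Ψ A p =
      (coefA α p : ℂ) • ∑ A, gam A *ᵥ nablaSpinor g e Ψ A p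
      + (coefB α β p : ℂ) • (slash (vel (Ψ p)) *ᵥ
        ∑ F, (vel (Ψ p) F : ℂ) • nablaSpinor g e Ψ F p)
      + (1 / 2 : ℂ) • ∑ D, ((coefB α β p * velLow (Ψ p) D * expansion
          (fun A B D => structureFn g e A B D p) (vel (Ψ p))
          (fun A B => dirDeriv (e B) (fun q => vel (Ψ q) A) p)
        + coefB α β p * accel g e Ψ D p
        - ((3 * coefA α p + 2 * coefB α β p) * projGrad e Ψ (coefA α) D p
          + coefA α p * projGrad e Ψ (coefB α β) D p) / (coefA α p + coefB α β p) : ℝ) : ℂ) •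
          (gam D *ᵥ Ψ p)
      + (Complex.I / 2 * coefB α β p ^ 2 / (coefA α p + coefB α β p)) •
        (slash (fun C => vort g e Ψ C p) *ᵥ (gam5 *ᵥ Ψ p)) := by
  have hC : ∀ A B D, structureFn g e A B D p = -structureFn g e A D B p := structureFn_antisymm p
  have hS : (fun A B D => structureFn (disformal g e α β Ψ) (disformalTetrad e α β Ψ) A B D p) =
      hatStructure (fun A B D => structureFn g e A B D p) (vel (Ψ p))
        (fun A B => dirDeriv (e B) (fun q => vel (Ψ q) A) p) (coefA α p) (coefB α β p)
        (fun D => dirDeriv (e D) (coefA α) p) (fun D => dirDeriv (e D) (coefB α β) p) := by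
    funext A B D
    exact h.structureFn_disformal hn p A B D
  have hhat : ∀ A B D, hatStructure (fun A B D => structureFn g e A B D p) (vel (Ψ p))
        (fun A B => dirDeriv (e B) (fun q => vel (Ψ q) A) p) (coefA α p) (coefB α β p)
        (fun D => dirDeriv (e D) (coefA α) p) (fun D => dirDeriv (e D) (coefB α β) p) A B D =
      -hatStructure (fun A B D => structureFn g e A B D p) (vel (Ψ p))
        (fun A B => dirDeriv (e B) (fun q => vel (Ψ q) A) p) (coefA α p) (coefB α β p)
        (fun D => dirDeriv (e D) (coefA α) p) (fun D => dirDeriv (e D) (coefB α β) p) A D B := by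
    rw [← hS]
    exact structureFn_antisymm p
  have key := sum_gam_spinTerm_hatStructure hC (sum_eta_vel_sq (h.timelike p))
    (fun D => h.sum_eta_vel_dirDeriv hn p (e D)) (h.coefA_pos p).ne' (h.coefA_add_coefB_pos p).ne'
    hda hhat (h.vort_eq hn p) (Ψ p)
  have hgrad : ∀ (f : M → ℝ) (D : Fin 4), projGrad e Ψ f D p = dirDeriv (e D) f p
      - eta D * vel (Ψ p) D * ∑ A, vel (Ψ p) A * dirDeriv (e A) f p := by
    intro f D
    simp only [projGrad, proj, velLow, sub_mul, Finset.sum_sub_distrib, ite_mul, one_mul, zero_mul,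
      Finset.sum_ite_eq, Finset.mem_univ, if_true, Finset.mul_sum, mul_assoc]
  have hder : ∀ A, dirDeriv (disformalTetrad e α β Ψ A) Ψ p = coefA α p • dirDeriv (e A) Ψ p
      + (coefB α β p * velLow (Ψ p) A) • ∑ F, vel (Ψ p) F • dirDeriv (e F) Ψ p := by
    intro A
    rw [← dirDeriv_sum_smul (vel (Ψ p)) e Ψ p (Z := velField e Ψ) rfl]
    exact dirDeriv_smul_field_add _ _ _ _ rfl
  have hslash : ∀ φ : Spinor, ∑ A, ((coefB α β p * (eta A * vel (Ψ p) A) : ℝ) : ℂ) • (gam A *ᵥ φ) =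
      (coefB α β p : ℂ) • (slash (vel (Ψ p)) *ᵥ φ) := by
    intro φ
    rw [← sum_eta_smul_gam_mulVec, Finset.smul_sum]
    refine Finset.sum_congr rfl fun A _ => ?_
    rw [smul_smul, Complex.ofReal_mul]
  have hr : ∀ (r : ℝ) (φ : Spinor), r • φ = (r : ℂ) • φ := fun r φ => by
    ext i; simp
  simp only [nablaSpinor_eq, hS, Matrix.mulVec_add, Finset.sum_add_distrib, key, hder, hr,
    Matrix.mulVec_smul, velLow, hslash, ← h.accel_eq hn, ← hgrad, ← Finset.smul_sum, smul_add,
    ← slash_mulVec]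
  abel

/-- The expansion is `-(ln √J²)˙` by current conservation, and the value of `s₀` makes
`b V̸ ∇_V Ψ` cancel it; the acceleration condition cancels the gradients and the terms in `s₁`, and
the value of `s₂` cancels the two axial vorticity terms. The mass term of `a γ^A ∇_A Ψ` is left. -/
theorem IsSetting.diracEquation_disformal (h : IsSetting n g e α β Ψ) (hn : n ≠ 0)
    (hI : InInomataClass g e α β m Ψ) :
    DiracEquation (disformal g e α β Ψ) (disformalTetrad e α β Ψ) (fun p => √(α p) * m) Ψ := by
  obtain ⟨s₀, s₁, s₂, hI, hs₀, hs₂, hacc, hda, -⟩ := hI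
  intro p
  have hθ := h.expansion_eq hn (h.diracEquation_of_inomata hI) p
  have hab : (coefA α p + coefB α β p : ℂ) ≠ 0 := by
    exact_mod_cast (h.coefA_add_coefB_pos p).ne'
  have hvel : ∀ D, ((coefB α β p * velLow (Ψ p) D * expansion
          (fun A B D => structureFn g e A B D p) (vel (Ψ p))
          (fun A B => dirDeriv (e B) (fun q => vel (Ψ q) A) p)
        + coefB α β p * accel g e Ψ D p
        - ((3 * coefA α p + 2 * coefB α β p) * projGrad e Ψ (coefA α) D p
          + coefA α p * projGrad e Ψ (coefB α β) D p) / (coefA α p + coefB α β p) : ℝ) : ℂ) =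
      -(coefB α β p * dot e Ψ (fun q => Real.log (currentNorm (Ψ q))) p : ℂ) *
          ((eta D * vel (Ψ p) D : ℝ) : ℂ)
        - 2 * coefB α β p * s₁ p * ((eta D * vort g e Ψ D p : ℝ) : ℂ) := by
    intro D
    have h1 := hacc p D
    rw [hθ, Complex.ofReal_sub, Complex.ofReal_add,
      Complex.ofReal_mul (coefB α β p) (accel _ _ _ _ _),
      h1, velLow, vortLow]
    push_cast
    ring
  rw [h.sum_gam_nablaSpinor_disformal hn p (hda p)]
  simp only [hvel, sub_smul, mul_smul, Finset.sum_sub_distrib, ← Finset.smul_sum,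
    sum_eta_smul_gam_mulVec, inomataCondition_iff.1 hI, sum_gam_inomataForm (h.timelike p),
    slash_vel_sum_inomataForm (h.timelike p) (sum_velLow_vort p), Matrix.mulVec_add,
    Matrix.mulVec_smul, hs₀, hs₂]
  generalize slash (vel (Ψ p)) *ᵥ Ψ p = u
  generalize slash (fun C => vort g e Ψ C p) *ᵥ Ψ p = x
  generalize slash (fun C => vort g e Ψ C p) *ᵥ (gam5 *ᵥ Ψ p) = y
  have ha : √(α p) = coefA α p := rfl
  rw [ha]
  match_scalars
  · linear_combination (-(coefA α p * m : ℂ)) * Complex.I_sq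
  · ring
  · ring
  · field_simp
    ring

end Geometry

/-! ### A Gödel-type example -/

section Goedel

variable (c d f : ℝ)

/-- The vector fields `∂_t`, `∂_x`, `e^{-cx} ∂_y + d ∂_t`, `∂_z` on `ℝ⁴`. -/
def goedelVec (A : Fin 4) (p : EuclideanSpace ℝ (Fin 4)) : EuclideanSpace ℝ (Fin 4) :=
  (if A = 2 then Real.exp (-(c * p 1)) else 1) • EuclideanSpace.single A (1 : ℝ)
    + (if A = 2 then d else 0) • EuclideanSpace.single 0 (1 : ℝ)

/-- The tetrad `∂_t`, `∂_x`, `e^{-cx} ∂_y + d ∂_t`, `∂_z` on `ℝ⁴`. -/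
def goedelFrame : Frame (EuclideanSpace ℝ (Fin 4)) := goedelVec c d

/-- The coframe `dt - d e^{cx} dy`, `dx`, `e^{cx} dy`, `dz`. -/
def goedelCoframe (A : Fin 4) (p : EuclideanSpace ℝ (Fin 4)) :
    EuclideanSpace ℝ (Fin 4) →ₗ[ℝ] ℝ :=
  (if A = 2 then Real.exp (c * p 1) else 1) •
      (EuclideanSpace.proj A : EuclideanSpace ℝ (Fin 4) →L[ℝ] ℝ).toLinearMap
    - (if A = 0 then d * Real.exp (c * p 1) else 0) •
      (EuclideanSpace.proj 2 : EuclideanSpace ℝ (Fin 4) →L[ℝ] ℝ).toLinearMap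

/-- The Gödel-type metric `(dt - d e^{cx} dy)² - dx² - e^{2cx} dy² - dz²`. -/
def goedelForm : FormField (EuclideanSpace ℝ (Fin 4)) := fun p =>
  ∑ A, eta A • (LinearMap.mul ℝ ℝ).compl₁₂ (goedelCoframe c d A p) (goedelCoframe c d A p)

theorem goedelForm_apply (p : EuclideanSpace ℝ (Fin 4)) (X Y : TangentSpace (𝓡 4) p) :
    goedelForm c d p X Y = ∑ A, eta A * (goedelCoframe c d A p X * goedelCoframe c d A p Y) := by
  simp only [goedelForm]
  rfl

theorem goedelCoframe_goedelVec (p : EuclideanSpace ℝ (Fin 4)) (A B : Fin 4) :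
    goedelCoframe c d A p (goedelVec c d B p) = if A = B then 1 else 0 := by
  have h : Real.exp (c * p 1) * Real.exp (-(c * p 1)) = 1 := by rw [← Real.exp_add]; simp
  fin_cases A <;> fin_cases B <;> simp [goedelCoframe, goedelVec, h, mul_assoc]

theorem goedelForm_frame (p : EuclideanSpace ℝ (Fin 4)) (A : Fin 4) (X : TangentSpace (𝓡 4) p) :
    goedelForm c d p (goedelFrame c d A p) X = eta A * goedelCoframe c d A p X := by
  have h : ∀ B, goedelCoframe c d B p (goedelFrame c d A p) = if B = A then 1 else 0 :=
    fun B => goedelCoframe_goedelVec c d p B A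
  rw [goedelForm_apply]
  simp [h]

theorem hasFDerivAt_goedelVec (A : Fin 4) (p : EuclideanSpace ℝ (Fin 4)) :
    HasFDerivAt (goedelVec c d A) ((if A = 2 then -(c * Real.exp (-(c * p 1))) else 0) •
      (EuclideanSpace.proj 1 : EuclideanSpace ℝ (Fin 4) →L[ℝ] ℝ).smulRight
        (EuclideanSpace.single A (1 : ℝ))) p := by
  by_cases hA : A = 2
  · subst hA
    have h1 : HasFDerivAt (fun q : EuclideanSpace ℝ (Fin 4) => q 1)
        (EuclideanSpace.proj 1 : EuclideanSpace ℝ (Fin 4) →L[ℝ] ℝ) p :=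
      (EuclideanSpace.proj 1 : EuclideanSpace ℝ (Fin 4) →L[ℝ] ℝ).hasFDerivAt
    have h2 := (((h1.const_mul c).neg.exp).smul_const
      (EuclideanSpace.single (2 : Fin 4) (1 : ℝ))).add_const (d • EuclideanSpace.single 0 (1 : ℝ))
    refine h2.congr_fderiv ?_
    ext v i
    simp
    ring_nf
  · have h1 : goedelVec c d A = fun _ => EuclideanSpace.single A (1 : ℝ) := by
      funext q; simp [goedelVec, hA]
    rw [h1]
    refine (hasFDerivAt_const _ _).congr_fderiv ?_
    ext v i
    simp [hA]

theorem contDiff_goedelVec (A : Fin 4) {n : WithTop ℕ∞} : ContDiff ℝ n (goedelVec c d A) := by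
  unfold goedelVec
  split_ifs <;> fun_prop

/-- The structure functions of the Gödel tetrad, from `[∂_x, e_2] = -c (e_2 - d ∂_t)`. -/
def goedelStructure (A B D : Fin 4) : ℝ :=
  ((if B = 2 ∧ D = 1 then 1 else 0) - (if D = 2 ∧ B = 1 then 1 else 0)) *
    ((if A = 0 then c * d else 0) + (if A = 2 then c else 0))

theorem structureFn_goedel (A B D : Fin 4) (p : EuclideanSpace ℝ (Fin 4)) :
    structureFn (goedelForm c d) (goedelFrame c d) A B D p = goedelStructure c d A B D := by
  have h : Real.exp (c * p 1) * Real.exp (-(c * p 1)) = 1 := by rw [← Real.exp_add]; simp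
  have hb : VectorField.mlieBracket (𝓡 4) (goedelFrame c d D) (goedelFrame c d B) p =
      fderiv ℝ (goedelVec c d B) p (goedelVec c d D p)
      - fderiv ℝ (goedelVec c d D) p (goedelVec c d B p) := by
    rw [← VectorField.mlieBracketWithin_univ, VectorField.mlieBracketWithin_eq_lieBracketWithin]
    exact congrFun VectorField.lieBracketWithin_univ p
  have hs : structureFn (goedelForm c d) (goedelFrame c d) A B D p =
      eta A * goedelCoframe c d A p (fderiv ℝ (goedelVec c d B) p (goedelVec c d D p)
        - fderiv ℝ (goedelVec c d D) p (goedelVec c d B p)) :=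
    (goedelForm_frame c d p A _).trans (congrArg (fun v => eta A * goedelCoframe c d A p v) hb)
  have h1 : ∀ B, goedelVec c d B p 1 = if B = 1 then 1 else 0 := by
    intro B
    fin_cases B <;> simp [goedelVec]
  have h2 : ∀ B v, fderiv ℝ (goedelVec c d B) p v =
      (if B = 2 then -(c * Real.exp (-(c * p 1))) * v 1 else 0) •
        EuclideanSpace.single (2 : Fin 4) (1 : ℝ) := by
    intro B v
    rw [(hasFDerivAt_goedelVec c d B p).fderiv]
    by_cases hB : B = 2
    · subst hB
      simp [mul_smul]
    · simp [hB]
  have h3 : eta A * goedelCoframe c d A p (EuclideanSpace.single (2 : Fin 4) (1 : ℝ)) =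
      -Real.exp (c * p 1) * ((if A = 0 then d else 0) + (if A = 2 then 1 else 0)) := by
    fin_cases A <;> simp [goedelCoframe, eta, mul_comm]
  rw [hs, h2, h2, map_sub, map_smul, map_smul, smul_eq_mul, smul_eq_mul, mul_sub,
    mul_left_comm, h3, mul_left_comm (eta A), h3, h1, h1, goedelStructure]
  have h4 : (if A = 0 then c * d else 0) + (if A = 2 then c else 0) =
      c * ((if A = 0 then d else 0) + (if A = 2 then 1 else 0)) := by
    split_ifs <;> ring
  rw [h4]
  generalize (if A = 0 then d else 0) + (if A = 2 then 1 else 0) = k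
  have h5 : ∀ B D : Fin 4, (if B = 2 then -(c * Real.exp (-(c * p 1))) * (if D = 1 then 1 else 0)
      else 0) = -(c * Real.exp (-(c * p 1))) * (if B = 2 ∧ D = 1 then 1 else 0) := by
    intro B D
    split_ifs <;> simp_all
  rw [h5, h5]
  linear_combination (c * k * ((if B = 2 ∧ D = 1 then 1 else 0) -
    (if D = 2 ∧ B = 1 then 1 else 0))) * h

theorem isTetrad_goedel : IsTetrad ⊤ (goedelForm c d) (goedelFrame c d) where
  regular A := contMDiff_vectorSpace_iff_contDiff.2 (contDiff_goedelVec c d A)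
  orthonormal p A B := by
    exact (goedelForm_frame c d p A _).trans (by
      rw [show goedelCoframe c d A p (goedelFrame c d B p) = _ from
        goedelCoframe_goedelVec c d p A B]; simp)

theorem isLorentzMetric_goedel : IsLorentzMetric ⊤ (goedelForm c d) where
  symm p X Y := by simp only [goedelForm_apply, mul_comm]
  signature p := (isTetrad_goedel c d).exists_basis p
  regular X Y hX hY := by
    have hX' : ContDiff ℝ ∞ (E := EuclideanSpace ℝ (Fin 4)) (F := EuclideanSpace ℝ (Fin 4)) X :=
      contMDiff_vectorSpace_iff_contDiff.1 hX
    have hY' : ContDiff ℝ ∞ (E := EuclideanSpace ℝ (Fin 4)) (F := EuclideanSpace ℝ (Fin 4)) Y :=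
      contMDiff_vectorSpace_iff_contDiff.1 hY
    refine ContDiff.contMDiff ?_
    have hc : ∀ (Z : EuclideanSpace ℝ (Fin 4) → EuclideanSpace ℝ (Fin 4)) (_ : ContDiff ℝ ∞ Z)
        (A : Fin 4), ContDiff ℝ ∞ fun p => goedelCoframe c d A p (Z p) := by
      intro Z hZ A
      have hZi : ∀ i, ContDiff ℝ ∞ fun p => Z p i := fun i => by fun_prop
      simp only [goedelCoframe, LinearMap.sub_apply, LinearMap.smul_apply]
      change ContDiff ℝ ∞ fun p : EuclideanSpace ℝ (Fin 4) =>
        (if A = 2 then Real.exp (c * p 1) else 1) * Z p A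
          - (if A = 0 then d * Real.exp (c * p 1) else 0) * Z p 2
      split_ifs <;> fun_prop
    simp only [goedelForm_apply]
    exact ContDiff.sum fun A _ => contDiff_const.mul ((hc X hX' A).mul (hc Y hY' A))

/-- The spinor field `e^{ift} (1, 0, 0, 0)`. -/
def goedelSpinor (p : EuclideanSpace ℝ (Fin 4)) : Spinor :=
  Complex.exp ((f * p 0 : ℝ) * Complex.I) • ![1, 0, 0, 0]

theorem phase_mul_conj (p : EuclideanSpace ℝ (Fin 4)) :
    (starRingEnd ℂ) (Complex.exp ((f * p 0 : ℝ) * Complex.I)) *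
      Complex.exp ((f * p 0 : ℝ) * Complex.I) = 1 := by
  rw [mul_comm, Complex.mul_conj, Complex.normSq_eq_norm_sq, Complex.norm_exp_ofReal_mul_I]
  simp

theorem bilin_goedelSpinor (Q : Matrix (Fin 4) (Fin 4) ℂ) (p : EuclideanSpace ℝ (Fin 4)) :
    bilin Q (goedelSpinor f p) = bilin Q ![1, 0, 0, 0] := by
  rw [bilin, goedelSpinor, star_smul, Matrix.mulVec_smul, smul_dotProduct, dotProduct_smul,
    smul_smul, Complex.star_def, phase_mul_conj, one_smul, bilin]

theorem current_goedelSpinor (p : EuclideanSpace ℝ (Fin 4)) (A : Fin 4) :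
    current (goedelSpinor f p) A = if A = 0 then 1 else 0 := by
  rw [current, bilin_goedelSpinor, bilin_eq]
  fin_cases A <;> simp [gam_zero_mulVec, gam_one_mulVec, gam_two_mulVec, gam_three_mulVec,
    dotProduct, Fin.sum_univ_four]

theorem scalarA_goedelSpinor (p : EuclideanSpace ℝ (Fin 4)) :
    scalarA (goedelSpinor f p) = 1 := by
  rw [scalarA, bilin_goedelSpinor, bilin_eq]
  simp [gam_zero_mulVec, dotProduct, Fin.sum_univ_four]

theorem scalarB_goedelSpinor (p : EuclideanSpace ℝ (Fin 4)) :
    scalarB (goedelSpinor f p) = 0 := by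
  rw [scalarB, bilin_goedelSpinor, bilin_eq]
  simp [gam_zero_mulVec, gam5_mulVec, dotProduct, Fin.sum_univ_four]

theorem currentSq_goedelSpinor (p : EuclideanSpace ℝ (Fin 4)) :
    currentSq (goedelSpinor f p) = 1 := by
  simp [currentSq, current_goedelSpinor, eta]

theorem currentNorm_goedelSpinor (p : EuclideanSpace ℝ (Fin 4)) :
    currentNorm (goedelSpinor f p) = 1 := by
  rw [currentNorm, currentSq_goedelSpinor, Real.sqrt_one]

theorem vel_goedelSpinor (p : EuclideanSpace ℝ (Fin 4)) (A : Fin 4) :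
    vel (goedelSpinor f p) A = if A = 0 then 1 else 0 := by
  rw [vel, current_goedelSpinor, currentNorm_goedelSpinor, div_one]

theorem velLow_goedelSpinor (p : EuclideanSpace ℝ (Fin 4)) (A : Fin 4) :
    velLow (goedelSpinor f p) A = if A = 0 then 1 else 0 := by
  rw [velLow, vel_goedelSpinor]
  fin_cases A <;> simp [eta]

theorem contDiff_goedelSpinor {n : WithTop ℕ∞} : ContDiff ℝ n (goedelSpinor f) := by
  unfold goedelSpinor
  have h : ContDiff ℝ n fun p : EuclideanSpace ℝ (Fin 4) =>
      Complex.exp ((f * p 0 : ℝ) * Complex.I) :=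
    ((Complex.ofRealCLM.contDiff.comp (by fun_prop : ContDiff ℝ n
      fun p : EuclideanSpace ℝ (Fin 4) => f * p 0)).mul contDiff_const).cexp
  exact h.smul contDiff_const

/-- The spinor depends on `t` only, so that the derivatives along `∂_t` and `e_2` are the nonzero
ones. -/
theorem dirDeriv_goedelSpinor (A : Fin 4) (p : EuclideanSpace ℝ (Fin 4)) :
    dirDeriv (goedelFrame c d A) (goedelSpinor f) p =
      (((if A = 0 then f else 0) + (if A = 2 then f * d else 0) : ℝ) * Complex.I : ℂ) •
        goedelSpinor f p := by
  have h1 : HasFDerivAt (fun q : EuclideanSpace ℝ (Fin 4) => f * q 0)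
      (f • (EuclideanSpace.proj 0 : EuclideanSpace ℝ (Fin 4) →L[ℝ] ℝ)) p :=
    ((EuclideanSpace.proj 0 : EuclideanSpace ℝ (Fin 4) →L[ℝ] ℝ).hasFDerivAt).const_mul f
  have h2 := (((Complex.ofRealCLM.hasFDerivAt.comp p h1).mul_const Complex.I).cexp).smul_const
    (![1, 0, 0, 0] : Spinor)
  have h3 : HasFDerivAt (goedelSpinor f) _ p := h2
  have h4 : dirDeriv (goedelFrame c d A) (goedelSpinor f) p =
      fderiv ℝ (goedelSpinor f) p (goedelVec c d A p) := by
    rw [← mfderiv_eq_fderiv]; rfl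
  have h5 : goedelVec c d A p 0 = (if A = 0 then 1 else 0) + (if A = 2 then d else 0) := by
    fin_cases A <;> simp [goedelVec]
  have h6 : f * goedelVec c d A p 0 = (if A = 0 then f else 0) + (if A = 2 then f * d else 0) := by
    rw [h5]; split_ifs <;> ring
  rw [h4, h3.fderiv, ← h6, goedelSpinor, smul_smul]
  simp
  ring

theorem isSetting_goedel : IsSetting ⊤ (goedelForm c d) (goedelFrame c d) (fun _ => 25)
    (fun _ => -9) (goedelSpinor f) where
  metric := isLorentzMetric_goedel c d
  tetrad := isTetrad_goedel c d
  regular_alpha := contMDiff_const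
  regular_beta := contMDiff_const
  regular_spinor := (contDiff_goedelSpinor f).contMDiff
  alpha_pos _ := by norm_num
  add_pos _ := by norm_num
  timelike p := by rw [currentSq_goedelSpinor]; norm_num

theorem vort_goedel (p : EuclideanSpace ℝ (Fin 4)) (A : Fin 4) :
    vort (goedelForm c d) (goedelFrame c d) (goedelSpinor f) A p =
      if A = 3 then -(c * d) / 2 else 0 := by
  rw [(isSetting_goedel c d f).vort_eq WithTop.top_ne_zero]
  simp only [structureFn_goedel, vel_goedelSpinor, velStructure]
  fin_cases A <;> simp [alt, eta, goedelStructure, dirDeriv_const]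
  ring

theorem accel_goedel (p : EuclideanSpace ℝ (Fin 4)) (A : Fin 4) :
    accel (goedelForm c d) (goedelFrame c d) (goedelSpinor f) A p = 0 := by
  rw [(isSetting_goedel c d f).accel_eq WithTop.top_ne_zero]
  simp only [structureFn_goedel, vel_goedelSpinor, acceleration]
  fin_cases A <;> simp [conn, goedelStructure, dirDeriv_const]

/-- Here `A = 1`, `B = 0`, `√J² = 1`, `V = ∂_t`, and `α = 25`, `β = -9` give `a = 5`, `b = -1`, so
that `s₂ = i/8`, while `s₀ = im/3`. With `ω³ = -cd/2` the components along `e_1` and `e_2` of the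
Inomata condition ask for `cd/4 = -m/3 + cd/16`, that is `cd = -16m/9`; the phase along `∂_t` has to
satisfy `f - cd/4 = -m/9`, that is `f = -5m/9`, and the phase along `e_2` has to cancel the rotation
of the tetrad, `f d = c/2`. Hence `d² = 8/5` and `c = 2 f d`. -/
theorem inInomataClass_goedel (m : ℝ) :
    InInomataClass (goedelForm (4 * √10 * m / 9) (-(2 * √10 / 5)))
      (goedelFrame (4 * √10 * m / 9) (-(2 * √10 / 5))) (fun _ => 25) (fun _ => -9) m
      (goedelSpinor (-(5 * m / 9))) := by
  have h10 : √10 * √10 = 10 := Real.mul_self_sqrt (by norm_num)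
  have ha : coefA (fun _ : EuclideanSpace ℝ (Fin 4) => (25 : ℝ)) = fun _ => 5 := by
    funext p
    rw [coefA, show (25 : ℝ) = 5 ^ 2 by norm_num, Real.sqrt_sq (by norm_num)]
  have hb : coefB (fun _ : EuclideanSpace ℝ (Fin 4) => (25 : ℝ)) (fun _ => -9) = fun _ => -1 := by
    funext p
    rw [coefB, show (25 : ℝ) + -9 = 4 ^ 2 by norm_num, show (25 : ℝ) = 5 ^ 2 by norm_num,
      Real.sqrt_sq (by norm_num), Real.sqrt_sq (by norm_num)]
    norm_num
  have hcd : 4 * √10 * m / 9 * -(2 * √10 / 5) = -(16 * m / 9) := by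
    linear_combination (-(8 * m / 45)) * h10
  have hfd : -(5 * m / 9) * -(2 * √10 / 5) = (4 * √10 * m / 9) / 2 := by ring
  generalize 4 * √10 * m / 9 = c at *
  generalize -(2 * √10 / 5) = d at *
  refine ⟨fun _ => Complex.I * m / 3, fun _ => 0, fun _ => Complex.I / 8,
    inomataCondition_iff.2 fun p B => ?_, fun p => ?_, fun p => ?_, fun p A => ?_, fun p => ?_,
    fun p => ?_⟩
  · rw [nablaSpinor_eq, dirDeriv_goedelSpinor, inomataForm, scalarA_goedelSpinor,
      scalarB_goedelSpinor, currentNorm_goedelSpinor, velLow_goedelSpinor]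
    simp only [structureFn_goedel, vort_goedel, hcd, hfd]
    have hu : goedelSpinor (-(5 * m / 9)) p =
        ![Complex.exp ((-(5 * m / 9) * p 0 : ℝ) * Complex.I), 0, 0, 0] := by
      simp [goedelSpinor]
    rw [hu]
    generalize Complex.exp ((-(5 * m / 9) * p 0 : ℝ) * Complex.I) = u
    have hcd' : (c * d : ℂ) = -(16 * m / 9) := by exact_mod_cast hcd
    have hsl : ∀ φ : Spinor, slash (fun C => if C = 3 then - -(16 * m / 9) / 2 else 0) *ᵥ φ =
        (8 * m / 9 : ℂ) • (gamLow 3 *ᵥ φ) := by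
      intro φ
      rw [slash_mulVec, Finset.sum_eq_single 3]
      · simp
        congr 1
        ring
      · intro C _ hC
        simp [hC]
      · simp
    rw [hsl]
    fin_cases B <;> ext i <;> fin_cases i <;>
    simp [Matrix.neg_mulVec, spinTerm, conn, goedelStructure, Fin.sum_univ_four, Matrix.sub_mulVec,
      gamLow,
      ← Matrix.mulVec_mulVec, gam_zero_mulVec, gam_one_mulVec, gam_two_mulVec,
      gam_three_mulVec, gam5_mulVec, eta]
    · linear_combination (-(Complex.I * u) / 4) * hcd'
    · linear_combination (Complex.I * u / 4) * hcd'
    · ring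
    · linear_combination (-u / 4) * hcd' + (4 * m / 9 * u) * Complex.I_sq
    · ring
  · simp [dot, scalarA_goedelSpinor, currentNorm_goedelSpinor, dirDeriv_const]
  · simp only [ha, hb]
    push_cast
    ring
  · simp [ha, hb, projGrad, dirDeriv_const, accel_goedel]
  · simp [dot, ha, dirDeriv_const]
  · simp [prime, ha, hb, dirDeriv_const]

end Goedel

end

end DisformalDirac

theorem theorem1 :
    -- Results on an arbitrary space-time.
    (∀ (M : Type*) [TopologicalSpace M] [ChartedSpace (EuclideanSpace ℝ (Fin 4)) M]
      [IsManifold (𝓡 4) ∞ M] (n : ℕ∞) (_ : 2 ≤ n) (m : ℝ)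
      (g : FormField M) (e : Frame M) (α β : M → ℝ) (Ψ : M → Spinor)
      (_ : IsSetting n g e α β Ψ),
      -- The disformal metric is a Lorentzian metric with contravariant components
      -- `α g^{μν} + β V^μ V^ν`, and `ê_A = a e_A + b V_A V` is a tetrad for it.
      (IsLorentzMetric n (disformal g e α β Ψ) ∧
        (∀ p, (Matrix.of fun A B => disformal g e α β Ψ p (e A p) (e B p)) *
          (Matrix.of fun A B => α p * (if A = B then eta A else 0)
            + β p * (vel (Ψ p) A * vel (Ψ p) B)) = 1) ∧
        IsTetrad n (disformal g e α β Ψ) (disformalTetrad e α β Ψ)) ∧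
      -- The generalized Inomata condition gives the Dirac equation in the target metric.
      (∀ s₀ s₁ s₂ : M → ℂ,
        InomataCondition g e m Ψ s₀ s₁ s₂ (fun p => -4 * s₁ p) (fun p => -4 * s₂ p) →
        DiracEquation g e (fun _ => m) Ψ) ∧
      -- Each member of the class solves the modified Dirac equation in the disformal metric
      -- and the Dirac equation in the target metric.
      (InInomataClass g e α β m Ψ →
        DiracEquation (disformal g e α β Ψ) (disformalTetrad e α β Ψ)
            (fun p => √(α p) * m) Ψ ∧
          DiracEquation g e (fun _ => m) Ψ)) ∧
    -- The class has members for every mass, for a genuinely disformal map.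
    (∀ m : ℝ, ∃ (g : FormField (EuclideanSpace ℝ (Fin 4)))
      (e : Frame (EuclideanSpace ℝ (Fin 4))) (α β : EuclideanSpace ℝ (Fin 4) → ℝ)
      (Ψ : EuclideanSpace ℝ (Fin 4) → Spinor),
      IsSetting ⊤ g e α β Ψ ∧ (∀ p, β p ≠ 0) ∧ InInomataClass g e α β m Ψ) := by
  refine ⟨fun M _ _ _ n hn m g e α β Ψ h => ?_, fun m => ?_⟩
  · have hn0 : n ≠ 0 := (lt_of_lt_of_le two_pos hn).ne'
    refine ⟨⟨h.isLorentzMetric_disformal, h.disformal_mul_inverse, h.isTetrad_disformal⟩,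
      fun s₀ s₁ s₂ hI => h.diracEquation_of_inomata hI,
      fun hI => ⟨h.diracEquation_disformal hn0 hI, ?_⟩⟩
    obtain ⟨s₀, s₁, s₂, hI, -⟩ := hI
    exact h.diracEquation_of_inomata hI
  · exact ⟨goedelForm (4 * √10 * m / 9) (-(2 * √10 / 5)),
      goedelFrame (4 * √10 * m / 9) (-(2 * √10 / 5)), fun _ => 25, fun _ => -9,
      goedelSpinor (-(5 * m / 9)), isSetting_goedel _ _ _, fun _ => by norm_num,
      inInomataClass_goedel m⟩
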